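/- Let $k$ be a field of characteristic zero, $A$ a commutative $k$-algebra and $\mathfrak g$ a $(k,A)$-Lie–Rinehart algebra, i.e. a $k$-Lie algebra and $A$-module with an $A$-linear map of Lie algebras $\alpha:\mathfrak g\to \mathrm{Der}_k(A)$ such that $[\delta,a\eta]=a[\delta,\eta]+\alpha(\delta)(a)\,\eta$ for all $\delta,\eta\in\mathfrak g$, $a\in A$. A $\mathfrak g$-connection on an $A$-module $W$ is an $A$-linear map $\nabla:\mathfrak g\to\mathrm{End}_k(W)$ with $\nabla(\delta)(aw)=a\nabla(\delta)(w)+\alpha(\delta)(a)w$. Its curvature is the form $R_\nabla\in C^2(\mathfrak g,\mathrm{End}_A(W))$, $R_\nabla(\delta,\eta)=[\nabla(\delta),\nabla(\eta)]-\nabla([\delta,\eta])$, where for an associative $A$-algebra $B$ we write $C^p(\mathfrak g,B)=\mathrm{Hom}_A(\bigwedge^p_A\mathfrak g,B)$ and $C^*(\mathfrak g,B)=\bigoplus_{p\ge0}C^p(\mathfrak g,B)$, an associative ring under the exterior (shuffle) product. Powers $R_\nabla^n\in C^{2n}(\mathfrak g,\mathrm{End}_A(W))$ are taken in this ring. Let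 $d$ be the differential of $C^*(\mathfrak g,A)$ given by $$ (d\omega)(g_1,\dots,g_{p+1})=\sum_{i}(-1)^{i+1}\alpha(g_i)\big(\omega(g_1,\dots,\widehat{g_i},\dots,g_{p+1})\big)+\sum_{i<j}(-1)^{i+j}\omega([g_i,g_j],g_1,\dots,\widehat{g_i},\dots,\widehat{g_j},\dots,g_{p+1}), $$ and let $H^*(\mathfrak g,A)$ be the cohomology ring of $(C^*(\mathfrak g,A),d)$. Let $K_0(\mathfrak g)$ be the Grothendieck ring of pairs $(W,\nabla)$, where $W$ is a locally free $A$-module of finite rank and $\nabla$ a $\mathfrak g$-connection on it: the free abelian group on isomorphism classes $[W,\nabla]$ modulo the relations $[W\oplus W',\nabla\oplus\nabla']=[W,\nabla]+[W',\nabla']$, with product $[W,\nabla]\cdot[W',\nabla']=[W\otimes_AW',\nabla\otimes1+1\otimes\nabla']$ and unit $[A,\alpha]$. Then for every such $(W,\nabla)$ and $n\ge0$ the form $\frac1{n!}\mathrm{tr}(R_\nabla^n)\in C^{2n}(\mathfrak g,A)$ is a cocycle, and there is a unique ring homomorphism $ch^{\mathfrak g}:K_0(\mathfrak g)\to H^*(\mathfrak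 g,A)$ such that for all $(W,\nabla)$ $$ ch^{\mathfrak g}[W,\nabla]=\sum_{n\ge0}\Big[\tfrac1{n!}\mathrm{tr}(R_\nabla^n)\Big], $$ the class of $\mathrm{tr}(\exp R_\nabla)$, where only finitely many of the classes on the right are nonzero. In particular $ch^{\mathfrak g}$ is well defined, additive on direct sums and multiplicative on tensor products. -/

import Mathlib

set_option linter.unusedSectionVars false

universe u

namespace LieRinehart

/-! ### Families of functions of several variables and their exterior product -/

/-- A family `(F_p)` of functions of `p` variables in `g` with values in `B`, one for every
`p ≥ 0`, written as a single function on finite sequences: `F_p (v₁, …, v_p) = F [v₁, …, v_p]`. -/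
structure SeqFun (g B : Type*) where
  toFun : List g → B

/-- All ways to split the sequence `l` into two complementary subsequences `l₁`, `l₂`, each with
the sign of the permutation that carries `l₁ ++ l₂` to `l` (that is, the `(p, q)`-shuffles for all
`p + q = l.length`). -/
def shuffles {g : Type*} : List g → List (ℤ × List g × List g)
  | [] => [(1, [], [])]
  | x :: l =>
      (shuffles l).map (fun s => (s.1, x :: s.2.1, s.2.2)) ++
      (shuffles l).map (fun s => ((-1) ^ s.2.1.length * s.1, s.2.1, x :: s.2.2))

namespace SeqFun

variable {g B : Type*}

instance : FunLike (SeqFun g B) (List g) B where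
  coe := toFun
  coe_injective := by rintro ⟨F⟩ ⟨G⟩ h; cases h; rfl

@[ext] theorem ext {F G : SeqFun g B} (h : ∀ l, F l = G l) : F = G := DFunLike.ext _ _ h

@[simp] theorem mk_apply (f : List g → B) (l : List g) : (⟨f⟩ : SeqFun g B) l = f l := rfl

instance [Zero B] : Zero (SeqFun g B) := ⟨⟨fun _ => 0⟩⟩
instance [Add B] : Add (SeqFun g B) := ⟨fun F G => ⟨fun l => F l + G l⟩⟩
instance [Neg B] : Neg (SeqFun g B) := ⟨fun F => ⟨fun l => -F l⟩⟩
instance [Sub B] : Sub (SeqFun g B) := ⟨fun F G => ⟨fun l => F l - G l⟩⟩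
instance {R : Type*} [SMul R B] : SMul R (SeqFun g B) := ⟨fun r F => ⟨fun l => r • F l⟩⟩

instance [AddCommGroup B] : AddCommGroup (SeqFun g B) :=
  Function.Injective.addCommGroup (fun F l => F l) (fun _ _ h => ext (congrFun h))
    rfl (fun _ _ => rfl) (fun _ => rfl) (fun _ _ => rfl) (fun _ _ => rfl) (fun _ _ => rfl)

/-- The contraction `ι_x F`, that is `(ι_x F)(v₁, …, v_p) = F(x, v₁, …, v_p)`. -/
def contr (x : g) (F : SeqFun g B) : SeqFun g B := ⟨fun l => F (x :: l)⟩

theorem apply_cons (x : g) (F : SeqFun g B) (l : List g) : F (x :: l) = contr x F l := rfl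
@[simp] theorem smul_apply {R : Type*} [SMul R B] (r : R) (F : SeqFun g B) (l : List g) :
    (r • F) l = r • F l := rfl
@[simp] theorem contr_smul {R : Type*} [SMul R B] (x : g) (r : R)
    (F : SeqFun g B) : contr x (r • F) = r • contr x F := rfl

section
variable [AddCommGroup B]

@[simp] theorem add_apply (F G : SeqFun g B) (l : List g) : (F + G) l = F l + G l := rfl
@[simp] theorem neg_apply (F : SeqFun g B) (l : List g) : (-F) l = -F l := rfl
@[simp] theorem sub_apply (F G : SeqFun g B) (l : List g) : (F - G) l = F l - G l := rfl
@[simp] theorem zero_apply (l : List g) : (0 : SeqFun g B) l = 0 := rfl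

instance {R : Type*} [Semiring R] [Module R B] : Module R (SeqFun g B) where
  one_smul _ := by ext; simp
  mul_smul _ _ _ := by ext; simp [mul_smul]
  smul_zero _ := by ext; simp
  smul_add _ _ _ := by ext; simp
  add_smul _ _ _ := by ext; simp [add_smul]
  zero_smul _ := by ext; simp

instance {R S : Type*} [SMul R B] [SMul S B] [SMul R S] [IsScalarTower R S B] :
    IsScalarTower R S (SeqFun g B) :=
  ⟨fun r s F => by ext l; simp⟩

/-- The sign involution: multiplication by `(-1)^p` in degree `p`. -/
def eps (F : SeqFun g B) : SeqFun g B := ⟨fun l => (-1 : ℤ) ^ l.length • F l⟩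

theorem eps_apply (F : SeqFun g B) (l : List g) : eps F l = (-1 : ℤ) ^ l.length • F l := rfl
@[simp] theorem contr_add (x : g) (F G : SeqFun g B) :
    contr x (F + G) = contr x F + contr x G := rfl
@[simp] theorem contr_zero (x : g) : contr x (0 : SeqFun g B) = 0 := rfl
@[simp] theorem contr_neg (x : g) (F : SeqFun g B) : contr x (-F) = -contr x F := rfl
@[simp] theorem contr_sub (x : g) (F G : SeqFun g B) :
    contr x (F - G) = contr x F - contr x G := rfl
@[simp] theorem eps_nil (F : SeqFun g B) : eps F [] = F [] := by simp [eps_apply]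
theorem eps_add (F G : SeqFun g B) : eps (F + G) = eps F + eps G := by
  ext l; simp [eps_apply, smul_add]
@[simp] theorem eps_eps (F : SeqFun g B) : eps (eps F) = F := by
  ext l; simp [eps_apply, smul_smul, ← mul_pow]
@[simp] theorem contr_eps (x : g) (F : SeqFun g B) : contr x (eps F) = -eps (contr x F) := by
  ext l; simp [← apply_cons, eps_apply, pow_succ]
@[simp] theorem eps_smul {R : Type*} [Semiring R] [Module R B] (r : R) (F : SeqFun g B) :
    eps (r • F) = r • eps F := by
  ext l; simp only [eps_apply, smul_apply]; rw [smul_comm]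
@[simp] theorem eps_zero : eps (0 : SeqFun g B) = 0 := by ext l; simp [eps_apply]
@[simp] theorem eps_neg (F : SeqFun g B) : eps (-F) = -eps F := by ext l; simp [eps_apply]
end

section Ring
variable [Ring B]

/-- The exterior product
`(F ∧ G)(v₁, …, v_n) = ∑ sgn(σ) F(v_σ(1), …, v_σ(p)) G(v_σ(p+1), …, v_σ(n))`,
the sum running over all `p + q = n` and all `(p, q)`-shuffles `σ`. -/
instance : Mul (SeqFun g B) :=
  ⟨fun F G => ⟨fun l => ((shuffles l).map fun s => s.1 • (F s.2.1 * G s.2.2)).sum⟩⟩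

/-- The unit: the constant `1` in degree `0`. -/
instance : One (SeqFun g B) := ⟨⟨fun l => if l.isEmpty then 1 else 0⟩⟩

theorem mul_apply (F G : SeqFun g B) (l : List g) :
    (F * G) l = ((shuffles l).map fun s => s.1 • (F s.2.1 * G s.2.2)).sum := rfl

@[simp] theorem one_nil : (1 : SeqFun g B) [] = 1 := rfl
@[simp] theorem contr_one (x : g) : contr x (1 : SeqFun g B) = 0 := rfl
@[simp] theorem eps_one : eps (1 : SeqFun g B) = 1 := by
  ext l; cases l <;> simp [eps_apply, apply_cons]

@[simp] theorem mul_nil (F G : SeqFun g B) : (F * G) [] = F [] * G [] := by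
  simp [mul_apply, shuffles]

theorem contr_mul (x : g) (F G : SeqFun g B) :
    contr x (F * G) = contr x F * G + eps F * contr x G := by
  ext l
  simp only [← apply_cons, mul_apply, shuffles, List.map_append, List.sum_append, List.map_map,
    add_apply, Function.comp_def, eps_apply]
  congr 2
  apply List.map_congr_left
  intro s _
  rw [smul_mul_assoc, smul_smul, mul_comm]

theorem mul_add' (F G H : SeqFun g B) : F * (G + H) = F * G + F * H := by
  ext l
  simp [mul_apply, mul_add, List.sum_map_add]

theorem add_mul' (F G H : SeqFun g B) : (F + G) * H = F * H + G * H := by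
  ext l
  simp [mul_apply, add_mul, List.sum_map_add]

theorem zero_mul' (F : SeqFun g B) : 0 * F = 0 := by ext l; simp [mul_apply]
theorem mul_zero' (F : SeqFun g B) : F * 0 = 0 := by ext l; simp [mul_apply]
theorem neg_mul' (F G : SeqFun g B) : -F * G = -(F * G) := by
  rw [eq_neg_iff_add_eq_zero, ← add_mul', neg_add_cancel, zero_mul']
theorem mul_neg' (F G : SeqFun g B) : F * -G = -(F * G) := by
  rw [eq_neg_iff_add_eq_zero, ← mul_add', neg_add_cancel, mul_zero']

theorem one_mul' (F : SeqFun g B) : 1 * F = F := by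
  ext l
  induction l generalizing F with
  | nil => simp
  | cons x l ih =>
    rw [apply_cons, contr_mul, contr_one, zero_mul', eps_one, add_apply, ih, apply_cons]; simp

theorem mul_one' (F : SeqFun g B) : F * 1 = F := by
  ext l
  induction l generalizing F with
  | nil => simp
  | cons x l ih =>
    rw [apply_cons, contr_mul, contr_one, mul_zero', add_apply, ih, apply_cons]; simp

theorem eps_mul (F G : SeqFun g B) : eps (F * G) = eps F * eps G := by
  ext l
  induction l generalizing F G with
  | nil => simp
  | cons x l ih =>
    rw [apply_cons, apply_cons, contr_eps, contr_mul, contr_mul,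
      contr_eps, contr_eps, eps_add, neg_apply, add_apply, ih, ih, neg_mul', mul_neg', eps_eps]
    simp; abel

theorem mul_assoc' (F G H : SeqFun g B) : F * G * H = F * (G * H) := by
  ext l
  induction l generalizing F G H with
  | nil => simp [mul_assoc]
  | cons x l ih =>
    rw [apply_cons, apply_cons, contr_mul, contr_mul, contr_mul,
      contr_mul, add_mul', mul_add', eps_mul]
    simp only [add_apply, ih]
    abel

instance : Ring (SeqFun g B) where
  left_distrib := mul_add'
  right_distrib := add_mul'
  zero_mul := zero_mul'
  mul_zero := mul_zero'
  mul_assoc := mul_assoc'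
  one_mul := one_mul'
  mul_one := mul_one'
  zsmul := fun n F => n • F
  zsmul_zero' := SubNegMonoid.zsmul_zero'
  zsmul_succ' := SubNegMonoid.zsmul_succ'
  zsmul_neg' := SubNegMonoid.zsmul_neg'
  neg_add_cancel := neg_add_cancel
  sub_eq_add_neg := sub_eq_add_neg

instance {R : Type*} [CommSemiring R] [Algebra R B] : Algebra R (SeqFun g B) :=
  Algebra.ofModule
    (fun r F G => by ext l; simp [mul_apply, List.smul_sum, Function.comp_def])
    (fun r F G => by ext l; simp [mul_apply, List.smul_sum, Function.comp_def])

end Ring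

end SeqFun

/-! ### Alternating multilinear families -/

/-- Every member `F_p` of the family is an alternating `A`-multilinear map on `g`, that is an
element of `Hom_A(⋀^p g, B)`. -/
def IsAlternating (A : Type*) {g B : Type*} [CommRing A] [AddCommGroup g] [Module A g]
    [AddCommGroup B] [Module A B] (F : SeqFun g B) : Prop :=
  ∀ p : ℕ, ∃ f : g [⋀^Fin p]→ₗ[A] B, ∀ v : Fin p → g, F (List.ofFn v) = f v

section Alternating

theorem ofFn_update {g : Type*} {p : ℕ} (v : Fin p → g) (i : Fin p) (x : g) :
    List.ofFn (Function.update v i x) =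
      (List.ofFn v).take i ++ x :: (List.ofFn v).drop (i + 1) := by
  have h : (List.ofFn v).set i x = (List.ofFn v).take i ++ x :: (List.ofFn v).drop (i + 1) := by
    rw [List.set_eq_take_append_cons_drop, if_pos (by simp)]
  rw [← h]
  apply List.ext_getElem (by simp)
  intro n h1 h2
  by_cases hn : (i : ℕ) = n
  · subst hn; simp
  · rw [List.getElem_set_ne hn, List.getElem_ofFn, List.getElem_ofFn,
      Function.update_of_ne (fun e => hn (congrArg Fin.val e).symm)]

variable {A g B : Type*} [CommRing A] [AddCommGroup g] [Module A g] [AddCommGroup B] [Module A B]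

/-- The same condition in terms of sequences. -/
structure IsAltSeq (A : Type*) {g B : Type*} [CommRing A] [AddCommGroup g] [Module A g]
    [AddCommGroup B] [Module A B] (F : SeqFun g B) : Prop where
  add : ∀ l₁ x y l₂, F (l₁ ++ (x + y) :: l₂) = F (l₁ ++ x :: l₂) + F (l₁ ++ y :: l₂)
  smul : ∀ l₁ (a : A) x l₂, F (l₁ ++ (a • x) :: l₂) = a • F (l₁ ++ x :: l₂)
  alt : ∀ l₁ x l₂, F (l₁ ++ x :: x :: l₂) = 0

namespace IsAltSeq

theorem contr {F : SeqFun g B} (hF : IsAltSeq A F) (x : g) : IsAltSeq A (F.contr x) where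
  add l₁ := hF.add (x :: l₁)
  smul l₁ := hF.smul (x :: l₁)
  alt l₁ := hF.alt (x :: l₁)

theorem contr_add {F : SeqFun g B} (hF : IsAltSeq A F) (x y : g) :
    F.contr (x + y) = F.contr x + F.contr y := by
  ext l; exact hF.add [] x y l

theorem contr_smul {F : SeqFun g B} (hF : IsAltSeq A F) (a : A) (x : g) :
    F.contr (a • x) = a • F.contr x := by
  ext l; exact hF.smul [] a x l

theorem contr_self {F : SeqFun g B} (hF : IsAltSeq A F) (x : g) :
    (F.contr x).contr x = 0 := by
  ext l; exact hF.alt [] x l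

theorem of_contr {F : SeqFun g B} (h : ∀ x, IsAltSeq A (F.contr x))
    (hadd : ∀ x y, F.contr (x + y) = F.contr x + F.contr y)
    (hsmul : ∀ (a : A) x, F.contr (a • x) = a • F.contr x)
    (halt : ∀ x, (F.contr x).contr x = 0) : IsAltSeq A F where
  add l₁ x y l₂ := by
    cases l₁ with
    | nil => exact DFunLike.congr_fun (hadd x y) l₂
    | cons z l₁ => exact (h z).add l₁ x y l₂
  smul l₁ a x l₂ := by
    cases l₁ with
    | nil => exact DFunLike.congr_fun (hsmul a x) l₂
    | cons z l₁ => exact (h z).smul l₁ a x l₂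
  alt l₁ x l₂ := by
    cases l₁ with
    | nil => exact DFunLike.congr_fun (halt x) l₂
    | cons z l₁ => exact (h z).alt l₁ x l₂

theorem swap {F : SeqFun g B} (hF : IsAltSeq A F) (l₁ : List g) (x y : g) (l₂ : List g) :
    F (l₁ ++ x :: y :: l₂) = -F (l₁ ++ y :: x :: l₂) := by
  have h := hF.alt l₁ (x + y) l₂
  have e1 := hF.add l₁ x y ((x + y) :: l₂)
  have e2 := hF.add (l₁ ++ [x]) x y l₂
  have e3 := hF.add (l₁ ++ [y]) x y l₂
  simp only [List.append_assoc, List.singleton_append] at e2 e3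
  rw [e1, e2, e3, hF.alt, hF.alt, zero_add, add_zero] at h
  exact eq_neg_of_add_eq_zero_left h

theorem contr_swap {F : SeqFun g B} (hF : IsAltSeq A F) (x y : g) :
    (F.contr x).contr y = -(F.contr y).contr x := by
  ext l; exact hF.swap [] x y l

theorem zero : IsAltSeq A (0 : SeqFun g B) := ⟨by simp, by simp, by simp⟩
theorem add' {F G : SeqFun g B} (hF : IsAltSeq A F) (hG : IsAltSeq A G) : IsAltSeq A (F + G) where
  add l₁ x y l₂ := by simp only [SeqFun.add_apply, hF.add, hG.add]; abel
  smul l₁ a x l₂ := by simp only [SeqFun.add_apply, hF.smul, hG.smul, smul_add]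
  alt l₁ x l₂ := by simp only [SeqFun.add_apply, hF.alt, hG.alt, add_zero]
theorem smul' {R : Type*} [Semiring R] [Module R B] [SMulCommClass R A B] (r : R)
    {F : SeqFun g B} (hF : IsAltSeq A F) : IsAltSeq A (r • F) where
  add l₁ x y l₂ := by simp only [SeqFun.smul_apply, hF.add, smul_add]
  smul l₁ a x l₂ := by simp only [SeqFun.smul_apply, hF.smul, smul_comm r]
  alt l₁ x l₂ := by simp only [SeqFun.smul_apply, hF.alt, smul_zero]
theorem neg' {F : SeqFun g B} (hF : IsAltSeq A F) : IsAltSeq A (-F) := by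
  simpa using hF.smul' (-1 : ℤ)
theorem sub' {F G : SeqFun g B} (hF : IsAltSeq A F) (hG : IsAltSeq A G) :
    IsAltSeq A (F - G) := by
  simpa [sub_eq_add_neg] using hF.add' hG.neg'
theorem eps {F : SeqFun g B} (hF : IsAltSeq A F) : IsAltSeq A F.eps where
  add l₁ x y l₂ := by simp only [SeqFun.eps_apply, hF.add, smul_add]; simp
  smul l₁ a x l₂ := by simp only [SeqFun.eps_apply, hF.smul, smul_comm _ a]; simp
  alt l₁ x l₂ := by simp only [SeqFun.eps_apply, hF.alt, smul_zero]

theorem alt_append {F : SeqFun g B} (hF : IsAltSeq A F) (l₁ : List g) (x : g) (l₂ l₃ : List g) :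
    F (l₁ ++ x :: l₂ ++ x :: l₃) = 0 := by
  induction l₂ generalizing l₁ with
  | nil => simpa using hF.alt l₁ x l₃
  | cons y l₂ ih =>
    have h1 := hF.swap l₁ x y (l₂ ++ x :: l₃)
    have h2 := ih (l₁ ++ [y])
    simp only [List.append_assoc, List.cons_append, List.nil_append] at h1 h2 ⊢
    rw [h1, h2, neg_zero]

end IsAltSeq

theorem isAlternating_iff {F : SeqFun g B} : IsAlternating A F ↔ IsAltSeq A F := by
  constructor
  · intro h
    have key : ∀ (l₁ l₂ : List g), ∃ (φ : g →ₗ[A] B), ∀ x, F (l₁ ++ x :: l₂) = φ x := by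
      intro l₁ l₂
      obtain ⟨f, hf⟩ := h (l₁ ++ 0 :: l₂).length
      let v := (l₁ ++ 0 :: l₂).get
      let i : Fin (l₁ ++ 0 :: l₂).length := ⟨l₁.length, by simp⟩
      refine ⟨f.toMultilinearMap.toLinearMap v i, fun x => ?_⟩
      have := hf (Function.update v i x)
      rw [ofFn_update, List.ofFn_get] at this
      simpa [i, List.take_left', List.drop_append, List.drop_eq_nil_of_le] using this
    refine ⟨fun l₁ x y l₂ => ?_, fun l₁ a x l₂ => ?_, fun l₁ x l₂ => ?_⟩
    · obtain ⟨φ, hφ⟩ := key l₁ l₂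
      simp [hφ]
    · obtain ⟨φ, hφ⟩ := key l₁ l₂
      simp [hφ]
    · obtain ⟨f, hf⟩ := h (l₁ ++ x :: x :: l₂).length
      have := hf (l₁ ++ x :: x :: l₂).get
      rw [List.ofFn_get] at this
      rw [this]
      refine f.map_eq_zero_of_eq _ (i := ⟨l₁.length, by simp⟩) (j := ⟨l₁.length + 1, by simp⟩)
        ?_ (by simp)
      simp [List.getElem_append_right]
  · intro h p
    refine ⟨
      { toFun := fun v => F (List.ofFn v)
        map_update_add' := fun v i x y => ?_
        map_update_smul' := fun v i a x => ?_
        map_eq_zero_of_eq' := fun v i j hv hij => ?_ }, fun v => rfl⟩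
    · have e : ‹DecidableEq (Fin p)› = instDecidableEqFin p := Subsingleton.elim _ _
      subst e
      simp only [ofFn_update, h.add]
    · have e : ‹DecidableEq (Fin p)› = instDecidableEqFin p := Subsingleton.elim _ _
      subst e
      simp only [ofFn_update, h.smul]
    · wlog hlt : i < j generalizing i j
      · exact this j i hv.symm hij.symm (lt_of_le_of_ne (not_lt.mp hlt) hij.symm)
      have e : List.ofFn v = (List.ofFn v).take i ++ v i ::
          (((List.ofFn v).drop (i + 1)).take (j - i - 1)) ++ v i :: (List.ofFn v).drop (j + 1) := by
        have hi : (i : ℕ) < (List.ofFn v).length := by simp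
        have hj : (j : ℕ) < (List.ofFn v).length := by simp
        have h1 : (List.ofFn v).drop j = v j :: (List.ofFn v).drop (j + 1) := by
          rw [List.drop_eq_getElem_cons hj, List.getElem_ofFn]
        have h2 : (List.ofFn v).drop i = v i :: (List.ofFn v).drop (i + 1) := by
          rw [List.drop_eq_getElem_cons hi, List.getElem_ofFn]
        have h3 : ((List.ofFn v).drop (i + 1)).drop (j - i - 1) = (List.ofFn v).drop j := by
          rw [List.drop_drop]; congr 1; omega
        have hv' : v i = v j := hv
        conv_lhs => rw [← List.take_append_drop i (List.ofFn v), h2,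
          ← List.take_append_drop (j - i - 1) ((List.ofFn v).drop (i + 1)), h3, h1, ← hv']
        simp
      show F (List.ofFn v) = 0
      rw [e]
      exact h.alt_append _ _ _ _

end Alternating

/-! ### The algebra of cochains -/

section Cochains

variable {A g B : Type*} [CommRing A] [AddCommGroup g] [Module A g]

theorem IsAltSeq.one [Ring B] [Algebra A B] : IsAltSeq A (1 : SeqFun g B) :=
  .of_contr (fun x => by simpa using .zero) (by simp) (by simp) (by simp)

theorem IsAltSeq.mul [Ring B] [Algebra A B] {F G : SeqFun g B} (hF : IsAltSeq A F)
    (hG : IsAltSeq A G) : IsAltSeq A (F * G) where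
  add l₁ x y l₂ := by
    induction l₁ generalizing F G with
    | nil =>
      simp only [List.nil_append, SeqFun.apply_cons, SeqFun.contr_mul, hF.contr_add,
        hG.contr_add, add_mul, mul_add, SeqFun.add_apply]
      abel
    | cons z l₁ ih =>
      simp only [List.cons_append, SeqFun.apply_cons, SeqFun.contr_mul, SeqFun.add_apply,
        ih (hF.contr z) hG, ih hF.eps (hG.contr z)]
      abel
  smul l₁ a x l₂ := by
    induction l₁ generalizing F G with
    | nil =>
      simp only [List.nil_append, SeqFun.apply_cons, SeqFun.contr_mul, hF.contr_smul,
        hG.contr_smul, smul_mul_assoc, mul_smul_comm, SeqFun.add_apply, SeqFun.smul_apply, smul_add]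
    | cons z l₁ ih =>
      simp only [List.cons_append, SeqFun.apply_cons, SeqFun.contr_mul, SeqFun.add_apply,
        ih (hF.contr z) hG, ih hF.eps (hG.contr z), smul_add]
  alt l₁ x l₂ := by
    induction l₁ generalizing F G with
    | nil =>
      simp [SeqFun.apply_cons, SeqFun.contr_mul, hF.contr_self, hG.contr_self]
    | cons z l₁ ih =>
      simp only [List.cons_append, SeqFun.apply_cons, SeqFun.contr_mul, SeqFun.add_apply,
        ih (hF.contr z) hG, ih hF.eps (hG.contr z), add_zero]

/-- The family vanishes in all sufficiently high degrees. -/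
def IsBounded {g B : Type*} [Zero B] (F : SeqFun g B) : Prop :=
  ∃ N : ℕ, ∀ l : List g, N ≤ l.length → F l = 0

theorem shuffles_length {g : Type*} (l : List g) : ∀ s ∈ shuffles l, s.2.1.length + s.2.2.length = l.length := by
  induction l with
  | nil => simp [shuffles]
  | cons x l ih =>
    intro s hs
    simp only [shuffles, List.mem_append, List.mem_map] at hs
    rcases hs with ⟨t, ht, rfl⟩ | ⟨t, ht, rfl⟩ <;> have := ih t ht <;> simp <;> omega

theorem IsBounded.mul [Ring B] {F G : SeqFun g B} (hF : IsBounded F) (hG : IsBounded G) :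
    IsBounded (F * G) := by
  obtain ⟨N, hN⟩ := hF
  obtain ⟨M, hM⟩ := hG
  refine ⟨N + M, fun l hl => ?_⟩
  rw [SeqFun.mul_apply]
  apply List.sum_eq_zero
  intro b hb
  obtain ⟨s, hs, rfl⟩ := List.mem_map.mp hb
  have := shuffles_length l s hs
  rcases le_or_gt N s.2.1.length with h | h
  · rw [hN _ h]; simp
  · rw [hM _ (by omega)]; simp

/-- The graded algebra of cochains `C^*(g, B) = ⨁_{p ≥ 0} Hom_A(⋀^p g, B)` with values in an
associative `A`-algebra `B`, under the exterior product. An element is a family `(F_p)` of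
alternating `A`-multilinear maps with `F_p = 0` for almost all `p`. -/
def cochains (A g B : Type*) [CommRing A] [AddCommGroup g] [Module A g] [Ring B] [Algebra A B] :
    Subalgebra A (SeqFun g B) where
  carrier := {F | IsBounded F ∧ IsAlternating A F}
  mul_mem' := fun hF hG => ⟨hF.1.mul hG.1,
    isAlternating_iff.2 ((isAlternating_iff.1 hF.2).mul (isAlternating_iff.1 hG.2))⟩
  add_mem' := fun {F G} hF hG => ⟨by
      obtain ⟨N, hN⟩ := hF.1
      obtain ⟨M, hM⟩ := hG.1
      exact ⟨N + M, fun l hl => by simp [hN l (by omega), hM l (by omega)]⟩,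
    isAlternating_iff.2 ((isAlternating_iff.1 hF.2).add' (isAlternating_iff.1 hG.2))⟩
  algebraMap_mem' := fun a => ⟨⟨1, fun l hl => by
      obtain ⟨x, l, rfl⟩ := List.exists_cons_of_length_pos hl
      rw [Algebra.algebraMap_eq_smul_one, SeqFun.smul_apply, SeqFun.apply_cons]; simp⟩,
    isAlternating_iff.2 (by rw [Algebra.algebraMap_eq_smul_one]; exact IsAltSeq.one.smul' a)⟩

theorem mem_cochains [Ring B] [Algebra A B] {F : SeqFun g B} :
    F ∈ cochains A g B ↔ IsBounded F ∧ IsAltSeq A F :=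
  and_congr_right fun _ => isAlternating_iff

theorem eps_mem_cochains [Ring B] [Algebra A B] {F : SeqFun g B} (hF : F ∈ cochains A g B) :
    F.eps ∈ cochains A g B := by
  rw [mem_cochains] at hF ⊢
  obtain ⟨⟨N, hN⟩, hF⟩ := hF
  exact ⟨⟨N, fun l hl => by simp [SeqFun.eps_apply, hN l hl]⟩, hF.eps⟩

/-- Composition of cochains with an `A`-linear map of the coefficients. -/
def mapCochains {B' : Type*} [Ring B] [Algebra A B] [Ring B'] [Algebra A B'] (φ : B →ₗ[A] B') :
    cochains A g B →ₗ[A] cochains A g B' where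
  toFun F := ⟨⟨fun l => φ (F.1 l)⟩, by
    obtain ⟨F, hF⟩ := F
    rw [mem_cochains] at hF ⊢
    obtain ⟨⟨N, hN⟩, hF⟩ := hF
    exact ⟨⟨N, fun l hl => by simp [hN l hl]⟩,
      ⟨by simp [hF.add], by simp [hF.smul], by simp [hF.alt]⟩⟩⟩
  map_add' F G := by ext l; simp
  map_smul' a F := by ext l; simp

end Cochains

/-! ### Connections and the differential -/

section Connection

variable (k A g W : Type*) [CommRing k] [CommRing A] [Algebra k A] [LieRing g] [LieAlgebra k g]
  [Module A g] [LieRingModule g A] [LieRinehartRing A g] [LieRinehartAlgebra k A g]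
  [AddCommGroup W] [Module k W] [Module A W] [IsScalarTower k A W]

/-- A `g`-connection on the `A`-module `W`: an `A`-linear map `∇ : g → End_k(W)` such that
`∇_δ(a w) = a ∇_δ(w) + δ(a) w`, where `δ(a) = ⁅δ, a⁆` is the action of `g` on `A` through the
anchor `g → Der_k(A)`. -/
structure Connection where
  toLin : g →ₗ[A] (W →ₗ[k] W)
  leibniz : ∀ (δ : g) (a : A) (w : W), toLin δ (a • w) = a • toLin δ w + ⁅δ, a⁆ • w

variable {k A g W}

instance : CoeFun (Connection k A g W) (fun _ => g → W →ₗ[k] W) := ⟨fun D => D.toLin⟩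

namespace Connection

/-- The canonical connection on `A`, given by the anchor. -/
def canonical (k A g : Type*) [CommRing k] [CommRing A] [Algebra k A] [LieRing g] [LieAlgebra k g]
    [Module A g] [LieRingModule g A] [LieRinehartRing A g] [LieRinehartAlgebra k A g] :
    Connection k A g A where
  toLin :=
    { toFun := fun δ => LieModule.toEnd k g A δ
      map_add' := fun δ η => by simp
      map_smul' := fun a δ => by ext b; simp }
  leibniz δ a b := by simp

@[simp] theorem canonical_apply (δ : g) (a : A) : canonical k A g δ a = ⁅δ, a⁆ := rfl

/-- The curvature `R(δ, η) = [∇_δ, ∇_η] - ∇_[δ, η]`, an `A`-linear endomorphism of `W`. -/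
def curv (D : Connection k A g W) (δ η : g) : Module.End A W where
  toFun w := D δ (D η w) - D η (D δ w) - D ⁅δ, η⁆ w
  map_add' v w := by simp only [map_add]; abel
  map_smul' a w := by
    simp only [D.leibniz, map_add, RingHom.id_apply, lie_lie, sub_smul, smul_sub]
    abel

/-- The differential of the Lie-Rinehart complex:
`(dF)(v₁, …, v_{p+1}) = ∑_i (-1)^{i+1} ∇_{v_i} F(v₁, …, v̂_i, …, v_{p+1})`
`  + ∑_{i<j} (-1)^{i+j} F([v_i, v_j], v₁, …, v̂_i, …, v̂_j, …, v_{p+1})`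
(below, the positions are counted from `0`). -/
def diff (D : Connection k A g W) (F : SeqFun g W) : SeqFun g W :=
  ⟨fun l =>
    ∑ i : Fin l.length, (-1 : ℤ) ^ (i : ℕ) • D l[i] (F (l.eraseIdx i)) +
    ∑ i : Fin l.length, ∑ j : Fin l.length,
      if i < j then (-1 : ℤ) ^ (i + j : ℕ) • F (⁅l[i], l[j]⁆ :: (l.eraseIdx j).eraseIdx i) else 0⟩

/-- The Lie derivative along `x`. -/
def lieD (D : Connection k A g W) (x : g) (F : SeqFun g W) : SeqFun g W :=
  ⟨fun l => D x (F l) - ∑ i : Fin l.length, F (l.set i ⁅x, l[i]⁆)⟩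

variable (D : Connection k A g W)

theorem diff_apply (F : SeqFun g W) (l : List g) : D.diff F l =
    ∑ i : Fin l.length, (-1 : ℤ) ^ (i : ℕ) • D l[i] (F (l.eraseIdx i)) +
    ∑ i : Fin l.length, ∑ j : Fin l.length,
      if i < j then (-1 : ℤ) ^ (i + j : ℕ) • F (⁅l[i], l[j]⁆ :: (l.eraseIdx j).eraseIdx i)
      else 0 := rfl

theorem lieD_apply (x : g) (F : SeqFun g W) (l : List g) :
    D.lieD x F l = D x (F l) - ∑ i : Fin l.length, F (l.set i ⁅x, l[i]⁆) := rfl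

@[simp] theorem diff_nil (F : SeqFun g W) : D.diff F [] = 0 := by
  simp [diff_apply]

@[simp] theorem lieD_nil (x : g) (F : SeqFun g W) : D.lieD x F [] = D x (F []) := by
  simp [lieD_apply]

theorem diff_add (F G : SeqFun g W) : D.diff (F + G) = D.diff F + D.diff G := by
  ext l
  simp only [diff_apply, SeqFun.add_apply, map_add, smul_add, Finset.sum_add_distrib,
    ← Finset.sum_filter]
  abel

theorem diff_smul (c : k) (F : SeqFun g W) : D.diff (c • F) = c • D.diff F := by
  ext l
  simp only [diff_apply, SeqFun.smul_apply, map_smul, smul_add, Finset.smul_sum,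
    smul_comm c, smul_ite, smul_zero]

theorem sum_cons {g M : Type*} [AddCommMonoid M] (x : g) (l : List g)
    (f : Fin (x :: l).length → M) :
    ∑ i, f i = f ⟨0, Nat.succ_pos _⟩ + ∑ i : Fin l.length, f i.succ :=
  Fin.sum_univ_succ f

theorem lieD_add (x : g) (F G : SeqFun g W) : D.lieD x (F + G) = D.lieD x F + D.lieD x G := by
  ext l
  simp only [lieD_apply, SeqFun.add_apply, map_add, Finset.sum_add_distrib]
  abel

theorem lieD_smul (x : g) (a : A) (F : SeqFun g W) :
    D.lieD x (a • F) = a • D.lieD x F + ⁅x, a⁆ • F := by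
  ext l
  simp only [lieD_apply, SeqFun.add_apply, SeqFun.smul_apply, D.leibniz, smul_sub, Finset.smul_sum]
  abel

theorem contr_lieD (x z : g) (F : SeqFun g W) :
    (D.lieD x F).contr z = D.lieD x (F.contr z) - F.contr ⁅x, z⁆ := by
  ext l
  rw [← SeqFun.apply_cons, lieD_apply, SeqFun.sub_apply, lieD_apply]
  rw [sum_cons]
  simp [← SeqFun.apply_cons]
  abel

end Connection

theorem IsAltSeq.set_eq {A g W : Type*} [CommRing A] [AddCommGroup g] [Module A g]
    [AddCommGroup W] [Module A W] {F : SeqFun g W} (hF : IsAltSeq A F) (y : g) (l : List g)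
    (i : Fin l.length) : F (l.set i y) = (-1 : ℤ) ^ (i : ℕ) • F (y :: l.eraseIdx i) := by
  induction l generalizing F with
  | nil => exact i.elim0
  | cons x l ih =>
    refine Fin.cases ?_ (fun i => ?_) i
    · simp
    · have := ih (hF.contr x) i
      simp only [← SeqFun.apply_cons] at this
      have h2 := hF.swap [] x y (l.eraseIdx i)
      simp only [List.nil_append] at h2
      simp [this, h2, pow_succ]

namespace Connection

variable (D : Connection k A g W)

theorem contr_diff {F : SeqFun g W} (hF : IsAltSeq A F) (x : g) :
    (D.diff F).contr x = D.lieD x F - D.diff (F.contr x) := by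
  ext l
  have hsw : ∀ (y : g) (l : List g), F (y :: x :: l) = -F (x :: y :: l) := fun y l =>
    hF.swap [] y x l
  rw [← SeqFun.apply_cons, diff_apply, SeqFun.sub_apply, lieD_apply, diff_apply]
  simp only [sum_cons]
  have hneg : ∀ (P : Prop) [Decidable P] (w : W),
      (if P then -w else 0) = -(if P then w else 0) := fun P _ w => by split <;> simp
  simp [hF.set_eq, ← SeqFun.apply_cons, hsw, pow_succ, pow_add, hneg]
  abel

theorem contr_lie {F : SeqFun g W} (hF : IsAltSeq A F) (x y : g) (a : A) :
    F.contr ⁅x, a • y⁆ = a • F.contr ⁅x, y⁆ + ⁅x, a⁆ • F.contr y := by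
  rw [LieRinehartRing.leibniz_smul_right, hF.contr_add, hF.contr_smul, hF.contr_smul]

theorem isAltSeq_lieD (x : g) {F : SeqFun g W} (hF : IsAltSeq A F) :
    IsAltSeq A (D.lieD x F) where
  add l₁ y z l₂ := by
    induction l₁ generalizing F with
    | nil =>
      simp only [List.nil_append, SeqFun.apply_cons, contr_lieD, hF.contr_add, lie_add, lieD_add,
        SeqFun.add_apply, SeqFun.sub_apply]
      abel
    | cons w l₁ ih =>
      simp only [List.cons_append, SeqFun.apply_cons, contr_lieD, SeqFun.sub_apply,
        ih (hF.contr w), (hF.contr _).add]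
      abel
  smul l₁ a y l₂ := by
    induction l₁ generalizing F with
    | nil =>
      simp only [List.nil_append, SeqFun.apply_cons, contr_lieD, contr_lie hF, hF.contr_smul,
        lieD_smul, SeqFun.add_apply, SeqFun.sub_apply, SeqFun.smul_apply, smul_sub]
      abel
    | cons w l₁ ih =>
      simp only [List.cons_append, SeqFun.apply_cons, contr_lieD, SeqFun.sub_apply,
        ih (hF.contr w), (hF.contr _).smul, smul_sub]
  alt l₁ y l₂ := by
    induction l₁ generalizing F with
    | nil =>
      have h0 : D.lieD x (0 : SeqFun g W) = 0 := by simpa using D.lieD_smul x (0 : A) 0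
      have h1 := hF.swap [] ⁅x, y⁆ y l₂
      simp only [List.nil_append] at h1
      simp only [List.nil_append, SeqFun.apply_cons, contr_lieD, SeqFun.contr_sub, hF.contr_self,
        SeqFun.sub_apply, h0] at h1 ⊢
      rw [h1]; simp
    | cons w l₁ ih =>
      simp only [List.cons_append, SeqFun.apply_cons, contr_lieD, SeqFun.sub_apply,
        ih (hF.contr w), (hF.contr _).alt, sub_zero]

theorem lieD_add_left {F : SeqFun g W} (hF : IsAltSeq A F) (x y : g) :
    D.lieD (x + y) F = D.lieD x F + D.lieD y F := by
  ext l
  simp only [lieD_apply, SeqFun.add_apply, map_add, LinearMap.add_apply, hF.set_eq, add_lie,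
    SeqFun.apply_cons, hF.contr_add, smul_add, Finset.sum_add_distrib]
  abel

theorem diff_smul_sub {F : SeqFun g W} (hF : IsAltSeq A F) (a : A) (x : g) :
    D.lieD (a • x) F - D.diff (a • F.contr x) = a • (D.lieD x F - D.diff (F.contr x)) := by
  ext l
  have h : ∀ y : g, ⁅a • x, y⁆ = a • ⁅x, y⁆ - ⁅y, a⁆ • x := fun y => by
    rw [← lie_skew, LieRinehartRing.leibniz_smul_right, ← lie_skew x y, smul_neg]; abel
  have hneg : ∀ y : g, F.contr (-y) = -F.contr y := fun y => by
    simpa using hF.contr_smul (-1) y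
  simp only [lieD_apply, diff_apply, SeqFun.smul_apply, D.leibniz, smul_add,
    Finset.smul_sum, Finset.sum_add_distrib, hF.set_eq, h, sub_eq_add_neg, smul_neg,
    SeqFun.apply_cons, hF.contr_add, hneg, hF.contr_smul, SeqFun.add_apply, SeqFun.neg_apply,
    map_smul, LinearMap.smul_apply, smul_comm _ a, smul_ite, smul_zero, Finset.sum_neg_distrib,
    neg_add, neg_neg]
  simp only [smul_comm a]
  abel

theorem lieD_contr_self {F : SeqFun g W} (hF : IsAltSeq A F) (x : g) :
    (D.lieD x F).contr x = D.lieD x (F.contr x) := by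
  have h : F.contr 0 = 0 := by simpa using hF.contr_smul 0 0
  rw [contr_lieD, lie_self, h, sub_zero]

theorem isAltSeq_diff {F : SeqFun g W} (hF : IsAltSeq A F) : IsAltSeq A (D.diff F) where
  add l₁ y z l₂ := by
    induction l₁ generalizing F with
    | nil =>
      simp only [List.nil_append, SeqFun.apply_cons, contr_diff D hF, hF.contr_add,
        lieD_add_left D hF, diff_add, SeqFun.add_apply, SeqFun.sub_apply]
      abel
    | cons w l₁ ih =>
      simp only [List.cons_append, SeqFun.apply_cons, contr_diff D hF, SeqFun.sub_apply,
        ih (hF.contr w), (isAltSeq_lieD D w hF).add]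
      abel
  smul l₁ a y l₂ := by
    induction l₁ generalizing F with
    | nil =>
      simp only [List.nil_append, SeqFun.apply_cons, contr_diff D hF, hF.contr_smul,
        diff_smul_sub D hF, SeqFun.smul_apply]
    | cons w l₁ ih =>
      simp only [List.cons_append, SeqFun.apply_cons, contr_diff D hF, SeqFun.sub_apply,
        ih (hF.contr w), (isAltSeq_lieD D w hF).smul, smul_sub]
  alt l₁ y l₂ := by
    induction l₁ generalizing F with
    | nil =>
      have h0 : D.diff (0 : SeqFun g W) = 0 := by simpa using D.diff_smul 0 0
      simp only [List.nil_append, SeqFun.apply_cons, contr_diff D hF, SeqFun.contr_sub,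
        contr_diff D (hF.contr y), hF.contr_self, lieD_contr_self D hF, h0]
      simp
    | cons w l₁ ih =>
      simp only [List.cons_append, SeqFun.apply_cons, contr_diff D hF, SeqFun.sub_apply,
        ih (hF.contr w), (isAltSeq_lieD D w hF).alt, sub_zero]

theorem isBounded_diff {F : SeqFun g W} (hF : IsBounded F) : IsBounded (D.diff F) := by
  obtain ⟨N, hN⟩ := hF
  refine ⟨N + 1, fun l hl => ?_⟩
  have h1 : ∀ i : Fin l.length, F (l.eraseIdx i) = 0 := fun i => hN _ (by
    rw [List.length_eraseIdx_of_lt i.2]; omega)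
  have h2 : ∀ (y : g) (i j : Fin l.length), i < j → F (y :: (l.eraseIdx j).eraseIdx i) = 0 :=
    fun y i j hij => hN _ (by
      have := i.2; have := j.2
      rw [List.length_cons, List.length_eraseIdx_of_lt, List.length_eraseIdx_of_lt j.2]
      · omega
      · rw [List.length_eraseIdx_of_lt j.2]; have : (i : ℕ) < j := hij; omega)
  rw [diff_apply]
  have h3 : ∀ i j : Fin l.length, (if i < j then (-1 : ℤ) ^ (i + j : ℕ) •
      F (⁅l[i], l[j]⁆ :: (l.eraseIdx j).eraseIdx i) else 0) = 0 := fun i j => by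
    split
    · rw [h2 _ _ _ ‹_›, smul_zero]
    · rfl
  simp only [h1, h3]; simp

theorem diff_neg (F : SeqFun g W) : D.diff (-F) = -D.diff F := by
  simpa using D.diff_smul (-1) F

theorem diff_sub (F G : SeqFun g W) : D.diff (F - G) = D.diff F - D.diff G := by
  rw [sub_eq_add_neg, diff_add, diff_neg, sub_eq_add_neg]

theorem lieD_sub (x : g) (F G : SeqFun g W) : D.lieD x (F - G) = D.lieD x F - D.lieD x G := by
  have := D.lieD_add x (F - G) G
  rw [sub_add_cancel] at this
  rw [this, add_sub_cancel_right]

theorem diff_eps (F : SeqFun g W) (l : List g) : D.diff F.eps l = -(D.diff F).eps l := by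
  have h1 : ∀ (i : Fin l.length) (w : W), (-1 : ℤ) ^ (l.eraseIdx i).length • w =
      -((-1 : ℤ) ^ l.length • w) := fun i w => by
    obtain ⟨m, hm⟩ : ∃ m, l.length = m + 1 := ⟨l.length - 1, by have := i.2; omega⟩
    rw [List.length_eraseIdx_of_lt i.2, hm]; simp [pow_succ]
  have h2 : ∀ (i j : Fin l.length), i < j → ∀ (y : g) (w : W),
      (-1 : ℤ) ^ (y :: (l.eraseIdx j).eraseIdx i).length • w = -((-1 : ℤ) ^ l.length • w) :=
    fun i j hij y w => by
      have hij' : (i : ℕ) < j := hij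
      have := j.2
      obtain ⟨m, hm⟩ : ∃ m, l.length = m + 2 := ⟨l.length - 2, by omega⟩
      rw [List.length_cons, List.length_eraseIdx_of_lt, List.length_eraseIdx_of_lt j.2, hm]
      · simp [pow_succ]
      · rw [List.length_eraseIdx_of_lt j.2]; omega
  have h3 : ∀ i j : Fin l.length, (if i < j then (-1 : ℤ) ^ (i + j : ℕ) •
        F.eps (⁅l[i], l[j]⁆ :: (l.eraseIdx j).eraseIdx i) else 0) =
      -((-1 : ℤ) ^ l.length • (if i < j then (-1 : ℤ) ^ (i + j : ℕ) •
        F (⁅l[i], l[j]⁆ :: (l.eraseIdx j).eraseIdx i) else 0)) := fun i j => by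
    split
    · rename_i h
      rw [SeqFun.eps_apply, h2 i j h, smul_neg, smul_comm]
    · simp
  rw [SeqFun.eps_apply, diff_apply, diff_apply]
  simp only [h3]
  simp only [SeqFun.eps_apply, h1, smul_add, neg_add, Finset.smul_sum, Finset.sum_neg_distrib,
    map_neg, smul_neg, map_zsmul]
  congr 2
  exact Finset.sum_congr rfl fun i _ => smul_comm _ _ _

theorem lieD_eps (x : g) (F : SeqFun g W) : D.lieD x F.eps = (D.lieD x F).eps := by
  ext l
  simp only [lieD_apply, SeqFun.eps_apply, smul_sub, Finset.smul_sum, map_zsmul, List.length_set]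

theorem lieD_lieD (hD : ∀ x y, D.curv x y = 0) {F : SeqFun g W} (hF : IsAltSeq A F) (x y : g) :
    D.lieD x (D.lieD y F) - D.lieD y (D.lieD x F) = D.lieD ⁅x, y⁆ F := by
  ext l
  induction l generalizing F with
  | nil =>
    have := LinearMap.congr_fun (hD x y) (F [])
    simp only [curv] at this
    simpa [sub_eq_zero] using this
  | cons z l ih =>
    have h : F.contr ⁅⁅x, y⁆, z⁆ = F.contr ⁅x, ⁅y, z⁆⁆ - F.contr ⁅y, ⁅x, z⁆⁆ := by
      have hneg : ∀ y : g, F.contr (-y) = -F.contr y := fun y => by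
        simpa using hF.contr_smul (-1) y
      rw [lie_lie, sub_eq_add_neg, hF.contr_add, hneg, ← sub_eq_add_neg]
    have := ih (hF.contr z)
    simp only [SeqFun.apply_cons, contr_lieD, SeqFun.contr_sub, lieD_sub, h, SeqFun.sub_apply]
      at this ⊢
    rw [← this]
    abel

theorem lieD_diff (hD : ∀ x y, D.curv x y = 0) {F : SeqFun g W} (hF : IsAltSeq A F) (x : g) :
    D.lieD x (D.diff F) = D.diff (D.lieD x F) := by
  ext l
  induction l generalizing F x with
  | nil => simp
  | cons z l ih =>
    have h1 := DFunLike.congr_fun (D.lieD_lieD hD hF x z) l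
    have h2 := ih (hF.contr z) x
    simp only [SeqFun.apply_cons, contr_lieD, contr_diff D hF, contr_diff D (isAltSeq_lieD D x hF),
      lieD_sub, diff_sub, SeqFun.sub_apply] at h1 h2 ⊢
    rw [h2, ← h1]
    abel

/-- For a flat connection, `d ∘ d = 0`. -/
theorem diff_diff (hD : ∀ x y, D.curv x y = 0) {F : SeqFun g W} (hF : IsAltSeq A F) :
    D.diff (D.diff F) = 0 := by
  ext l
  induction l generalizing F with
  | nil => simp
  | cons z l ih =>
    simp only [SeqFun.apply_cons, contr_diff D (isAltSeq_diff D hF), contr_diff D hF,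
      lieD_diff D hD hF, diff_sub, SeqFun.sub_apply, SeqFun.zero_apply, SeqFun.contr_zero]
    rw [ih (hF.contr z)]
    simp

end Connection

/-! The product rule, for a connection on an algebra that acts by derivations. -/

namespace Connection

variable {B : Type*} [Ring B] [Algebra k B] [Algebra A B] [IsScalarTower k A B]
  (D : Connection k A g B)

theorem lieD_mul (hD : ∀ (x : g) (b c : B), D x (b * c) = D x b * c + b * D x c) (x : g)
    (F G : SeqFun g B) : D.lieD x (F * G) = D.lieD x F * G + F * D.lieD x G := by
  ext l
  induction l generalizing F G with
  | nil => simp [hD]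
  | cons z l ih =>
    have h1 := ih (F.contr z) G
    have h2 := ih F.eps (G.contr z)
    simp only [SeqFun.apply_cons, contr_lieD, SeqFun.contr_mul, lieD_add, SeqFun.contr_add,
      SeqFun.sub_apply, SeqFun.add_apply, sub_mul, mul_sub, lieD_eps] at h1 h2 ⊢
    rw [h1, h2]
    abel

theorem diff_mul (hD : ∀ (x : g) (b c : B), D x (b * c) = D x b * c + b * D x c)
    {F G : SeqFun g B} (hF : IsAltSeq A F) (hG : IsAltSeq A G) :
    D.diff (F * G) = D.diff F * G + F.eps * D.diff G := by
  ext l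
  induction l generalizing F G with
  | nil => simp
  | cons z l ih =>
    have he : ∀ F : SeqFun g B, D.diff F.eps = -(D.diff F).eps := fun F => by
      ext l; rw [diff_eps]; rfl
    have h1 := ih (hF.contr z) hG
    have h2 := ih hF.eps (hG.contr z)
    simp only [SeqFun.apply_cons, contr_diff D (hF.mul hG), contr_diff D hF, contr_diff D hG,
      SeqFun.contr_mul, SeqFun.contr_add, lieD_mul D hD, diff_add, SeqFun.add_apply,
      SeqFun.sub_apply, sub_mul, mul_sub, SeqFun.contr_eps, SeqFun.eps_eps, he, neg_mul,
      SeqFun.neg_apply] at h1 h2 ⊢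
    rw [h1, h2]
    abel

end Connection
end Connection

/-! ### The cohomology ring `H^*(g, A)` -/

section Cohomology

variable (k A g : Type*) [CommRing k] [CommRing A] [Algebra k A] [LieRing g] [LieAlgebra k g]
  [Module A g] [LieRingModule g A] [LieRinehartRing A g] [LieRinehartAlgebra k A g]

theorem canonical_curv (x y : g) : (Connection.canonical k A g).curv x y = 0 := by
  ext; simp [Connection.curv]

theorem canonical_mul (x : g) (b c : A) : Connection.canonical k A g x (b * c) =
    Connection.canonical k A g x b * c + b * Connection.canonical k A g x c := by
  simp [add_comm]

/-- The differential of the complex `C^*(g, A)`; here `A` carries its canonical connection. -/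
def d : cochains A g A →ₗ[k] cochains A g A where
  toFun F := ⟨(Connection.canonical k A g).diff F.1, mem_cochains.2
    ⟨Connection.isBounded_diff _ (mem_cochains.1 F.2).1,
      Connection.isAltSeq_diff _ (mem_cochains.1 F.2).2⟩⟩
  map_add' _ _ := Subtype.ext (Connection.diff_add _ _ _)
  map_smul' _ _ := Subtype.ext (Connection.diff_smul _ _ _)

theorem d_d (F : cochains A g A) : d k A g (d k A g F) = 0 :=
  Subtype.ext (Connection.diff_diff _ (canonical_curv k A g) (mem_cochains.1 F.2).2)

/-- The sign involution on cochains. -/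
def sgn (F : cochains A g A) : cochains A g A := ⟨F.1.eps, eps_mem_cochains F.2⟩

theorem sgn_sgn (F : cochains A g A) : sgn A g (sgn A g F) = F := Subtype.ext (by simp [sgn])

theorem d_sgn (F : cochains A g A) : d k A g (sgn A g F) = -sgn A g (d k A g F) :=
  Subtype.ext (SeqFun.ext fun l => Connection.diff_eps _ _ l)

/-- `d` is a graded derivation. -/
theorem d_mul (F G : cochains A g A) :
    d k A g (F * G) = d k A g F * G + sgn A g F * d k A g G :=
  Subtype.ext (Connection.diff_mul _ (canonical_mul k A g) (mem_cochains.1 F.2).2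
    (mem_cochains.1 G.2).2)

theorem d_one : d k A g 1 = 0 := by
  have h := d_mul k A g 1 1
  have h1 : sgn A g 1 = 1 := Subtype.ext (by simp [sgn])
  rw [h1, mul_one, mul_one, one_mul] at h
  simpa using h

/-- The algebra of cocycles. -/
def cocycles : Subalgebra k (cochains A g A) where
  carrier := {F | d k A g F = 0}
  mul_mem' := fun {F G} hF hG => by
    simp only [Set.mem_ofPred_eq] at hF hG ⊢
    rw [d_mul, hF, hG, zero_mul, mul_zero, add_zero]
  add_mem' := fun {F G} hF hG => by
    simp only [Set.mem_ofPred_eq] at hF hG ⊢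
    rw [map_add, hF, hG, add_zero]
  algebraMap_mem' := fun c => by
    simp only [Set.mem_ofPred_eq]
    rw [Algebra.algebraMap_eq_smul_one, map_smul, d_one, smul_zero]

theorem mem_cocycles {F : cochains A g A} : F ∈ cocycles k A g ↔ d k A g F = 0 := Iff.rfl

/-- The two-sided ideal of coboundaries in the algebra of cocycles. -/
def coboundaries : TwoSidedIdeal (cocycles k A g) :=
  .mk' {z | ∃ F, d k A g F = z.1} ⟨0, map_zero _⟩
    (by rintro x y ⟨F, hF⟩ ⟨G, hG⟩; exact ⟨F + G, by rw [map_add, hF, hG]; rfl⟩)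
    (by rintro x ⟨F, hF⟩; exact ⟨-F, by rw [map_neg, hF]; rfl⟩)
    (by
      rintro x y ⟨F, hF⟩
      refine ⟨sgn A g x.1 * F, ?_⟩
      have hx : d k A g x.1 = 0 := x.2
      have h0 : sgn A g (0 : cochains A g A) = 0 := Subtype.ext (by simp [sgn])
      rw [d_mul, d_sgn, hx, sgn_sgn, h0, neg_zero, zero_mul, zero_add, hF]; rfl)
    (by
      rintro x y ⟨F, hF⟩
      refine ⟨F * y.1, ?_⟩
      have hy : d k A g y.1 = 0 := y.2
      rw [d_mul, hy, mul_zero, add_zero, hF]; rfl)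

/-- The cohomology ring `H^*(g, A) = ⨁_p H^p(g, A)`: cocycles modulo coboundaries. -/
def Cohomology : Type _ := (coboundaries k A g).ringCon.Quotient

noncomputable instance : Ring (Cohomology k A g) :=
  inferInstanceAs (Ring (coboundaries k A g).ringCon.Quotient)

/-- The class of a cocycle. -/
def Cohomology.mk : cocycles k A g →+* Cohomology k A g := (coboundaries k A g).ringCon.mk'

end Cohomology

/-! ### Locally free modules and the trace -/

/-- `W` is locally free of finite rank: every prime of `A` has a basic open neighbourhood `D(f)`
such that `W_f` is a free `A_f`-module of finite rank. -/
def IsLocallyFree (A W : Type*) [CommRing A] [AddCommGroup W] [Module A W] : Prop :=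
  ∀ p : PrimeSpectrum A, ∃ f ∉ p.asIdeal,
    Module.Free (Localization.Away f) (LocalizedModule.Away f W) ∧
    Module.Finite (Localization.Away f) (LocalizedModule.Away f W)

theorem isLocallyFree_iff {A W : Type*} [CommRing A] [AddCommGroup W] [Module A W] :
    IsLocallyFree A W ↔ Module.Finite A W ∧ Module.Projective A W := by
  constructor
  · intro h
    let s : Set A := {f | Module.Free (Localization.Away f) (LocalizedModule.Away f W) ∧
      Module.Finite (Localization.Away f) (LocalizedModule.Away f W)}
    have hs : Ideal.span s = ⊤ := by
      by_contra hne
      obtain ⟨m, hm, hle⟩ := Ideal.exists_le_maximal _ hne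
      obtain ⟨f, hf, hfs⟩ := h ⟨m, hm.isPrime⟩
      exact hf (hle (Ideal.subset_span hfs))
    have : Module.FinitePresentation A W :=
      Module.FinitePresentation.of_localizationSpan s hs fun g => by
        have h1 : Module.Free (Localization.Away g.1) (LocalizedModule.Away g.1 W) := g.2.1
        have h2 : Module.Finite (Localization.Away g.1) (LocalizedModule.Away g.1 W) := g.2.2
        exact Module.finitePresentation_of_projective _ _
    have : Module.Flat A W := Module.flat_of_localized_span A W s hs fun g => by
      have h1 : Module.Free (Localization.Away g.1) (LocalizedModule.Away g.1 W) := g.2.1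
      have : Module.Flat A (Localization.Away g.1) := IsLocalization.flat _ (Submonoid.powers g.1)
      exact Module.Flat.trans A (Localization.Away g.1) (LocalizedModule.Away g.1 W)
    exact ⟨inferInstance, Module.Flat.projective_of_finitePresentation⟩
  · rintro ⟨h1, h2⟩ p
    have : Module.FinitePresentation A W := Module.finitePresentation_of_projective A W
    have : Module.Free (Localization p.asIdeal.primeCompl)
        (LocalizedModule p.asIdeal.primeCompl W) := Module.free_of_flat_of_isLocalRing
    obtain ⟨f, hf, hfree, -⟩ := Module.FinitePresentation.exists_free_localizedModule_powers
      p.asIdeal.primeCompl (LocalizedModule.mkLinearMap p.asIdeal.primeCompl W)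
      (Localization p.asIdeal.primeCompl)
    exact ⟨f, hf, hfree, inferInstance⟩

/-- The trace `End_A(W) = W^* ⊗ W → A` for a finitely generated projective (that is, locally free
of finite rank) module `W`. -/
noncomputable def projTrace (A W : Type*) [CommRing A] [AddCommGroup W] [Module A W]
    [Module.Finite A W] [Module.Projective A W] : Module.End A W →ₗ[A] A :=
  contractLeft A W ∘ₗ (dualTensorHomEquiv A W W).symm.toLinearMap

/-- For free modules this is the trace of matrices. -/
theorem projTrace_eq_trace (A W : Type*) [CommRing A] [AddCommGroup W] [Module A W]
    [Module.Finite A W] [Module.Free A W] : projTrace A W = LinearMap.trace A W :=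
  (LinearMap.trace_eq_contract' A W).symm

/-! ### The curvature form -/

section Curvature

variable {k A g W : Type*} [CommRing k] [CommRing A] [Algebra k A] [LieRing g] [LieAlgebra k g]
  [Module A g] [LieRingModule g A] [LieRinehartRing A g] [LieRinehartAlgebra k A g]
  [AddCommGroup W] [Module k W] [Module A W] [IsScalarTower k A W]

namespace Connection

variable (D : Connection k A g W)

/-- The curvature as a family of functions, concentrated in degree `2`. -/
def curvSeq : SeqFun g (Module.End A W) :=
  ⟨fun
    | [δ, η] => D.curv δ η
    | _ => 0⟩

theorem diff_singleton (F : SeqFun g W) (δ : g) : D.diff F [δ] = D δ (F []) := by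
  have e : ∀ f : Fin [δ].length → W, ∑ i, f i = f ⟨0, Nat.succ_pos _⟩ := fun f =>
    Fin.sum_univ_one f
  simp only [diff_apply, e]
  simp

/-- The curvature is `d¹ ∘ d⁰`. -/
theorem curv_eq_diff_diff (w : W) (δ η : g) :
    D.curv δ η w = D.diff (D.diff ⟨fun l => if l.isEmpty then w else 0⟩) [δ, η] := by
  have e : ∀ f : Fin [δ, η].length → W,
      ∑ i, f i = f ⟨0, Nat.succ_pos _⟩ + f ⟨1, Nat.succ_lt_succ (Nat.succ_pos _)⟩ := fun f =>
    Fin.sum_univ_two f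
  rw [diff_apply]
  simp only [e]
  simp [diff_singleton, curv]
  abel

theorem curv_add_left (x y z : g) : D.curv (x + y) z = D.curv x z + D.curv y z := by
  ext w; simp [curv]; abel

theorem curv_smul_left (a : A) (x z : g) : D.curv (a • x) z = a • D.curv x z := by
  ext w
  have h : ⁅a • x, z⁆ = a • ⁅x, z⁆ - ⁅z, a⁆ • x := by
    rw [← lie_skew, LieRinehartRing.leibniz_smul_right, ← lie_skew x z, smul_neg]; abel
  simp [curv, h, D.leibniz, smul_sub]
  abel

theorem curv_self (x : g) : D.curv x x = 0 := by ext w; simp [curv]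

theorem curv_swap (x y : g) : D.curv x y = -D.curv y x := by
  ext w
  have h : ⁅x, y⁆ = -⁅y, x⁆ := (lie_skew x y).symm
  show D x (D y w) - D y (D x w) - D ⁅x, y⁆ w = -(D y (D x w) - D x (D y w) - D ⁅y, x⁆ w)
  rw [h, map_neg, LinearMap.neg_apply]
  abel

/-- The curvature form `R_∇ ∈ C^2(g, End_A(W))`. -/
def curvForm : cochains A g (Module.End A W) :=
  ⟨D.curvSeq, mem_cochains.2 ⟨⟨3, fun l hl => by
      match l, hl with
      | _ :: _ :: _ :: _, _ => rfl⟩,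
    { add := fun l₁ x y l₂ => by
        match l₁, l₂ with
        | [], [] => exact (add_zero _).symm
        | [], [z] => exact D.curv_add_left x y z
        | [], _ :: _ :: _ => exact (add_zero _).symm
        | [z], [] =>
          show D.curv z (x + y) = D.curv z x + D.curv z y
          rw [D.curv_swap, D.curv_add_left, D.curv_swap z x, D.curv_swap z y, neg_add]
        | [_], _ :: _ => exact (add_zero _).symm
        | [_, _], _ => exact (add_zero _).symm
        | _ :: _ :: _ :: _, _ => exact (add_zero _).symm
      smul := fun l₁ a x l₂ => by
        match l₁, l₂ with
        | [], [] => exact (smul_zero _).symm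
        | [], [z] => exact D.curv_smul_left a x z
        | [], _ :: _ :: _ => exact (smul_zero _).symm
        | [z], [] =>
          show D.curv z (a • x) = a • D.curv z x
          rw [D.curv_swap, D.curv_smul_left, D.curv_swap z x, smul_neg]
        | [_], _ :: _ => exact (smul_zero _).symm
        | [_, _], _ => exact (smul_zero _).symm
        | _ :: _ :: _ :: _, _ => exact (smul_zero _).symm
      alt := fun l₁ x l₂ => by
        match l₁, l₂ with
        | [], [] => exact D.curv_self x
        | [], _ :: _ => rfl
        | [_], _ => rfl
        | [_, _], _ => rfl
        | _ :: _ :: _ :: _, _ => rfl }⟩⟩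

/-! ### Direct sums and tensor products of connections -/

variable {W' : Type*} [AddCommGroup W'] [Module k W'] [Module A W'] [IsScalarTower k A W']

/-- The connection `∇ ⊕ ∇'` on `W ⊕ W'`. -/
def prod (D : Connection k A g W) (D' : Connection k A g W') : Connection k A g (W × W') where
  toLin :=
    { toFun := fun δ => (D δ).prodMap (D' δ)
      map_add' := fun δ η => by ext <;> simp
      map_smul' := fun a δ => by ext <;> simp }
  leibniz δ a w := by ext <;> simp [D.leibniz, D'.leibniz]

@[simp] theorem prod_apply (D : Connection k A g W) (D' : Connection k A g W') (δ : g)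
    (w : W × W') : D.prod D' δ w = (D δ w.1, D' δ w.2) := rfl

open TensorProduct in
/-- The additive map `∇_δ ⊗ 1 + 1 ⊗ ∇'_δ` on `W ⊗_A W'`. -/
def tensorAux (D : Connection k A g W) (D' : Connection k A g W') (δ : g) :
    W ⊗[A] W' →+ W ⊗[A] W' :=
  liftAddHom
    { toFun := fun w =>
        { toFun := fun w' => D δ w ⊗ₜ[A] w' + w ⊗ₜ[A] D' δ w'
          map_zero' := by simp
          map_add' := fun x y => by simp only [map_add, tmul_add]; abel }
      map_zero' := by ext; simp
      map_add' := fun x y => by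
        ext z
        simp only [AddMonoidHom.coe_mk, ZeroHom.coe_mk, AddMonoidHom.add_apply, map_add, add_tmul]
        abel }
    (fun a w w' => by
      simp only [AddMonoidHom.coe_mk, ZeroHom.coe_mk, D.leibniz, D'.leibniz, add_tmul, tmul_add,
        smul_tmul]
      abel)

open TensorProduct in
@[simp] theorem tensorAux_tmul (D : Connection k A g W) (D' : Connection k A g W') (δ : g)
    (w : W) (w' : W') :
    tensorAux D D' δ (w ⊗ₜ w') = D δ w ⊗ₜ[A] w' + w ⊗ₜ[A] D' δ w' := rfl

open TensorProduct in
/-- The connection `∇ ⊗ 1 + 1 ⊗ ∇'` on `W ⊗_A W'`. -/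
def tensor (D : Connection k A g W) (D' : Connection k A g W') :
    Connection k A g (W ⊗[A] W') where
  toLin :=
    { toFun := fun δ =>
        { toFun := tensorAux D D' δ
          map_add' := map_add _
          map_smul' := fun c x => by
            induction x with
            | zero => simp
            | tmul w w' => simp [smul_tmul', smul_add]
            | add x y hx hy => simp only [smul_add, map_add, hx, hy] }
      map_add' := fun δ η => by
        ext x
        induction x with
        | zero => simp
        | tmul w w' => simp [add_tmul, tmul_add]; abel
        | add x y hx hy => simp only [map_add, hx, hy]
      map_smul' := fun a δ => by
        ext x
        induction x with
        | zero => simp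
        | tmul w w' => simp [smul_tmul', smul_add]
        | add x y hx hy => simp only [map_add, hx, hy] }
  leibniz δ a x := by
    show tensorAux D D' δ (a • x) = a • tensorAux D D' δ x + ⁅δ, a⁆ • x
    induction x with
    | zero => simp
    | tmul w w' => simp [smul_tmul', D.leibniz, add_tmul, smul_add]; abel
    | add x y hx hy => simp only [smul_add, map_add, hx, hy]; abel

open TensorProduct in
@[simp] theorem tensor_tmul (D : Connection k A g W) (D' : Connection k A g W') (δ : g)
    (w : W) (w' : W') :
    D.tensor D' δ (w ⊗ₜ w') = D δ w ⊗ₜ[A] w' + w ⊗ₜ[A] D' δ w' := rfl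

end Connection
end Curvature

/-! ### The Grothendieck ring `K_0(g)` -/

theorem IsLocallyFree.prod {A W W' : Type*} [CommRing A] [AddCommGroup W] [Module A W]
    [AddCommGroup W'] [Module A W'] (h : IsLocallyFree A W) (h' : IsLocallyFree A W') :
    IsLocallyFree A (W × W') := by
  rw [isLocallyFree_iff] at h h' ⊢
  obtain ⟨_, _⟩ := h
  obtain ⟨_, _⟩ := h'
  exact ⟨inferInstance, inferInstance⟩

open TensorProduct in
theorem IsLocallyFree.tensor {A W W' : Type*} [CommRing A] [AddCommGroup W] [Module A W]
    [AddCommGroup W'] [Module A W'] (h : IsLocallyFree A W) (h' : IsLocallyFree A W') :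
    IsLocallyFree A (W ⊗[A] W') := by
  rw [isLocallyFree_iff] at h h' ⊢
  obtain ⟨_, _⟩ := h
  obtain ⟨_, _⟩ := h'
  exact ⟨inferInstance, inferInstance⟩

theorem IsLocallyFree.self (A : Type*) [CommRing A] : IsLocallyFree A A :=
  isLocallyFree_iff.2 ⟨inferInstance, inferInstance⟩

section Grothendieck

variable (k : Type*) (A : Type u) (g : Type*) [CommRing k] [CommRing A] [Algebra k A] [LieRing g]
  [LieAlgebra k g] [Module A g] [LieRingModule g A] [LieRinehartRing A g]
  [LieRinehartAlgebra k A g]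

/-- A pair `(W, ∇)` of a locally free `A`-module `W` of finite rank and a `g`-connection `∇`
on `W`. -/
structure ConnModule where
  carrier : Type u
  [addCommGroup : AddCommGroup carrier]
  [moduleBase : Module k carrier]
  [module : Module A carrier]
  [isScalarTower : IsScalarTower k A carrier]
  locallyFree : IsLocallyFree A carrier
  conn : Connection k A g carrier

attribute [instance] ConnModule.addCommGroup ConnModule.moduleBase ConnModule.module
  ConnModule.isScalarTower

variable {k A g}

namespace ConnModule

instance (V : ConnModule k A g) : Module.Finite A V.carrier := (isLocallyFree_iff.1 V.locallyFree).1

instance (V : ConnModule k A g) : Module.Projective A V.carrier :=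
  (isLocallyFree_iff.1 V.locallyFree).2

/-- Isomorphism of pairs: an `A`-linear isomorphism that is compatible with the connections. -/
def Iso (V W : ConnModule k A g) : Prop :=
  ∃ e : V.carrier ≃ₗ[A] W.carrier, ∀ (δ : g) (v : V.carrier), e (V.conn δ v) = W.conn δ (e v)

/-- The direct sum `(W ⊕ W', ∇ ⊕ ∇')`. -/
def dsum (V W : ConnModule k A g) : ConnModule k A g where
  carrier := V.carrier × W.carrier
  locallyFree := V.locallyFree.prod W.locallyFree
  conn := V.conn.prod W.conn

open TensorProduct in
/-- The tensor product `(W ⊗_A W', ∇ ⊗ 1 + 1 ⊗ ∇')`. -/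
noncomputable def tens (V W : ConnModule k A g) : ConnModule k A g where
  carrier := V.carrier ⊗[A] W.carrier
  locallyFree := V.locallyFree.tensor W.locallyFree
  conn := V.conn.tensor W.conn

variable (k A g) in
/-- The unit `(A, canonical connection)`. -/
def unit : ConnModule k A g where
  carrier := A
  locallyFree := .self A
  conn := Connection.canonical k A g

variable (k A g) in
/-- Isomorphism of pairs is an equivalence relation. -/
instance isoSetoid : Setoid (ConnModule k A g) where
  r := Iso
  iseqv :=
    { refl := fun V => ⟨LinearEquiv.refl _ _, fun _ _ => rfl⟩
      symm := fun {V W} ⟨e, he⟩ => ⟨e.symm, fun δ w => by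
        apply e.injective
        rw [he, e.apply_symm_apply, e.apply_symm_apply]⟩
      trans := fun {U V W} ⟨e, he⟩ ⟨f, hf⟩ => ⟨e.trans f, fun δ v => by simp [he, hf]⟩ }

open TensorProduct

theorem tens_congr {V V' W W' : ConnModule k A g} (h : Iso V V') (h' : Iso W W') :
    Iso (tens V W) (tens V' W') := by
  obtain ⟨e, he⟩ := h
  obtain ⟨f, hf⟩ := h'
  refine ⟨TensorProduct.congr e f, fun δ x => ?_⟩
  change V.carrier ⊗[A] W.carrier at x
  change TensorProduct.congr e f (V.conn.tensor W.conn δ x) =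
    V'.conn.tensor W'.conn δ (TensorProduct.congr e f x)
  induction x with
  | zero => simp
  | tmul v w => simp [he, hf]
  | add x y hx hy => simp only [map_add, hx, hy]

theorem tens_comm (V W : ConnModule k A g) : Iso (tens V W) (tens W V) := by
  refine ⟨TensorProduct.comm A V.carrier W.carrier, fun δ x => ?_⟩
  change V.carrier ⊗[A] W.carrier at x
  change TensorProduct.comm A V.carrier W.carrier (V.conn.tensor W.conn δ x) =
    W.conn.tensor V.conn δ (TensorProduct.comm A V.carrier W.carrier x)
  induction x with
  | zero => simp
  | tmul v w => simp [add_comm]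
  | add x y hx hy => simp only [map_add, hx, hy]

theorem unit_tens (V : ConnModule k A g) : Iso (tens (unit k A g) V) V := by
  refine ⟨TensorProduct.lid A V.carrier, fun δ x => ?_⟩
  change A ⊗[A] V.carrier at x
  change TensorProduct.lid A V.carrier ((Connection.canonical k A g).tensor V.conn δ x) =
    V.conn δ (TensorProduct.lid A V.carrier x)
  induction x with
  | zero => simp
  | tmul a v => simp [V.conn.leibniz, add_comm]
  | add x y hx hy => simp only [map_add, hx, hy]

theorem tens_assoc (U V W : ConnModule k A g) :
    Iso (tens (tens U V) W) (tens U (tens V W)) := by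
  refine ⟨TensorProduct.assoc A U.carrier V.carrier W.carrier, fun δ x => ?_⟩
  change (U.carrier ⊗[A] V.carrier) ⊗[A] W.carrier at x
  change TensorProduct.assoc A U.carrier V.carrier W.carrier
      ((U.conn.tensor V.conn).tensor W.conn δ x) =
    U.conn.tensor (V.conn.tensor W.conn) δ
      (TensorProduct.assoc A U.carrier V.carrier W.carrier x)
  induction x with
  | zero => simp
  | tmul y w =>
    induction y with
    | zero => simp
    | tmul u v => simp [add_tmul, tmul_add, add_assoc]
    | add y z hy hz => simp only [add_tmul, map_add, hy, hz]
  | add x y hx hy => simp only [map_add, hx, hy]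

theorem tens_dsum (U V W : ConnModule k A g) :
    Iso (tens U (dsum V W)) (dsum (tens U V) (tens U W)) := by
  refine ⟨TensorProduct.prodRight A A U.carrier V.carrier W.carrier, fun δ x => ?_⟩
  change U.carrier ⊗[A] (V.carrier × W.carrier) at x
  change TensorProduct.prodRight A A U.carrier V.carrier W.carrier
      (U.conn.tensor (V.conn.prod W.conn) δ x) =
    (U.conn.tensor V.conn).prod (U.conn.tensor W.conn) δ
      (TensorProduct.prodRight A A U.carrier V.carrier W.carrier x)
  induction x with
  | zero => simp; rfl
  | tmul u v => simp
  | add x y hx hy => simp only [map_add, hx, hy]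

end ConnModule

variable (k A g)

/-- The set of isomorphism classes `[W, ∇]`. -/
def IsoClass : Type _ := Quotient (ConnModule.isoSetoid k A g)

/-- Isomorphism classes form a commutative monoid under the tensor product. -/
noncomputable instance : CommMonoid (IsoClass k A g) where
  mul := Quotient.map₂ ConnModule.tens fun _ _ h _ _ h' => ConnModule.tens_congr h h'
  one := Quotient.mk _ (ConnModule.unit k A g)
  mul_assoc := by
    rintro ⟨U⟩ ⟨V⟩ ⟨W⟩
    exact Quotient.sound (ConnModule.tens_assoc U V W)
  one_mul := by
    rintro ⟨V⟩
    exact Quotient.sound (ConnModule.unit_tens V)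
  mul_one := by
    rintro ⟨V⟩
    exact Quotient.sound (Setoid.trans (ConnModule.tens_comm V _) (ConnModule.unit_tens V))
  mul_comm := by
    rintro ⟨V⟩ ⟨W⟩
    exact Quotient.sound (ConnModule.tens_comm V W)

variable {k A g} in
/-- The generator `[W, ∇]` of the free abelian group on isomorphism classes. This group is a
commutative ring, with `[W, ∇] [W', ∇'] = [W ⊗ W', ∇ ⊗ ∇']`. -/
noncomputable def symb (V : ConnModule k A g) : FreeAbelianGroup (IsoClass k A g) :=
  FreeAbelianGroup.of (Quotient.mk _ V)

variable {k A g} in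
theorem symb_mul (V W : ConnModule k A g) : symb V * symb W = symb (V.tens W) :=
  FreeAbelianGroup.of_mul_of _ _

/-- The relations `[W ⊕ W', ∇ ⊕ ∇'] - [W, ∇] - [W', ∇']`. -/
def relations : Set (FreeAbelianGroup (IsoClass k A g)) :=
  {x | ∃ V W : ConnModule k A g, x = symb (V.dsum W) - symb V - symb W}

/-- The subgroup `D` generated by the relations; it is an ideal. -/
noncomputable def relIdeal : Ideal (FreeAbelianGroup (IsoClass k A g)) where
  __ := AddSubgroup.closure (relations k A g)
  smul_mem' := by
    intro c x hx
    change x ∈ AddSubgroup.closure (relations k A g) at hx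
    change c * x ∈ AddSubgroup.closure (relations k A g)
    induction hx using AddSubgroup.closure_induction with
    | mem x hx =>
      obtain ⟨V, W, rfl⟩ := hx
      induction c using FreeAbelianGroup.induction_on with
      | zero => rw [zero_mul]; exact zero_mem _
      | of c =>
        obtain ⟨U, rfl⟩ := Quotient.exists_rep c
        change symb U * _ ∈ _
        refine AddSubgroup.subset_closure ⟨U.tens V, U.tens W, ?_⟩
        rw [mul_sub, mul_sub, symb_mul, symb_mul, symb_mul]
        congr 2
        exact congrArg FreeAbelianGroup.of (Quotient.sound (ConnModule.tens_dsum U V W))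
      | neg c hc => rw [neg_mul]; exact neg_mem hc
      | add c c' hc hc' => rw [add_mul]; exact add_mem hc hc'
    | zero => rw [mul_zero]; exact zero_mem _
    | add x y _ _ hx hy => rw [mul_add]; exact add_mem hx hy
    | neg x _ hx => rw [mul_neg]; exact neg_mem hx

/-- The Grothendieck ring `K_0(g)`: the free abelian group on the isomorphism classes `[W, ∇]`
modulo the relations `[W ⊕ W', ∇ ⊕ ∇'] = [W, ∇] + [W', ∇']`, with the product induced by `⊗`. -/
abbrev K0 : Type _ := FreeAbelianGroup (IsoClass k A g) ⧸ relIdeal k A g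

variable {k A g}

/-- The class `[W, ∇]` in `K_0(g)`. -/
noncomputable def K0.mk (V : ConnModule k A g) : K0 k A g := Ideal.Quotient.mk _ (symb V)

theorem K0.mk_dsum (V W : ConnModule k A g) : K0.mk (V.dsum W) = K0.mk V + K0.mk W := by
  have : symb (V.dsum W) - symb V - symb W ∈ relIdeal k A g :=
    AddSubgroup.subset_closure ⟨V, W, rfl⟩
  have h := Ideal.Quotient.eq_zero_iff_mem.2 this
  rw [map_sub, map_sub, sub_sub, sub_eq_zero] at h
  exact h

theorem K0.mk_tens (V W : ConnModule k A g) : K0.mk (V.tens W) = K0.mk V * K0.mk W :=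
  congrArg (Ideal.Quotient.mk (relIdeal k A g)) (symb_mul V W).symm

end Grothendieck

/-- The form `(1/n!) tr(R_∇^n)` in `C^{2n}(g, A)`, the term of degree `2n` of `tr(exp R_∇)`. -/
noncomputable def chForm {k : Type*} {A : Type u} {g : Type*} [Field k] [CommRing A] [Algebra k A]
    [LieRing g] [LieAlgebra k g] [Module A g] [LieRingModule g A] [LieRinehartRing A g]
    [LieRinehartAlgebra k A g] (V : ConnModule k A g) (n : ℕ) : cochains A g A :=
  (n.factorial : k)⁻¹ • mapCochains (projTrace A V.carrier) (V.conn.curvForm ^ n)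

end LieRinehart

/-! A connection `∇` acts on `End_A(W)` by commutators. The resulting operator `d_∇` on
`End_A(W)`-valued forms is a graded derivation, kills the curvature `R` (`diff_curvSeq`, the Bianchi
identity), and satisfies `tr ∘ d_∇ = d ∘ tr` (`projTrace_endo`, `canonical_diff_projTrace`). Hence
`d tr(R^n) = 0`. The facts about the trace all follow from `End_A(W) = W^* ⊗ W`: endomorphisms of
rank one suffice.

The class of `tr(R^n)` does not depend on `∇` (`exists_d_eq_sub`). On the line `∇ + sθ` the
curvature obeys `R_{s+h} = R_s + h d_s θ + h² θ ∧ θ`. Cyclicity of the trace turns the coefficient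
of `h` in `tr(R_{s+h}^n)` into `n tr(d_s θ ∧ R_s^{n-1})`, which is `d` of `n tr(θ ∧ R_s^{n-1})`. A
linear functional that kills coboundaries therefore takes on `tr(R_s^n)` a value that is polynomial
in `s` with zero derivative, hence constant in characteristic zero. Such functionals detect
coboundaries, and no integral over `s` is needed.

Finiteness is not a matter of degree, since `g` may have infinite rank. But `W` is a summand `p :
A^m → W`, `i : W → A^m` of a free module, and with `e = i p` the connection `p ∂ i` has curvature `p
(∂e ∧ ∂e) i`. This form is pulled back along `δ ↦ ∂_δ e` from the free module `End_A(A^m)` of finite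
rank, on which alternating forms of high degree vanish. So its powers are eventually zero
(`exists_curvSeq_pow_eq_zero`), and independence of `∇` carries the vanishing of classes to every
connection.

For a direct sum the curvature is block diagonal. For a tensor product it is `R ⊗ 1 + 1 ⊗ R'`; the
summands commute because they act on different factors and have even degree, so the binomial formula
and `tr(φ ⊗ ψ) = tr φ tr ψ` make `tr exp` multiplicative. Uniqueness holds because the classes `[W,
∇]` generate `K_0(g)` additively. -/

namespace LieRinehart

/-! ### Change of coefficients and of variables -/

namespace SeqFun

variable {g g' B B' C : Type*}

/-- Composition with a map of the coefficients. -/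
def map (φ : B → B') (F : SeqFun g B) : SeqFun g B' := ⟨fun l => φ (F l)⟩

@[simp] theorem map_apply (φ : B → B') (F : SeqFun g B) (l : List g) : F.map φ l = φ (F l) := rfl

/-- Composition with a map of the variables. -/
def comap (ρ : g → g') (F : SeqFun g' B) : SeqFun g B := ⟨fun l => F (l.map ρ)⟩

@[simp] theorem comap_apply (ρ : g → g') (F : SeqFun g' B) (l : List g) :
    F.comap ρ l = F (l.map ρ) := rfl

theorem contr_comap (ρ : g → g') (F : SeqFun g' B) (x : g) :
    (F.comap ρ).contr x = (F.contr (ρ x)).comap ρ := rfl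

section Ring
variable [Ring B] [Ring B']

theorem map_mul (φ : B →+* B') (F G : SeqFun g B) : (F * G).map φ = F.map φ * G.map φ := by
  ext l
  simp [mul_apply, map_list_sum, Function.comp_def]

theorem one_cons (x : g) (l : List g) : (1 : SeqFun g B) (x :: l) = 0 := rfl

theorem map_one (φ : B →+* B') : (1 : SeqFun g B).map φ = 1 := by
  ext l
  cases l <;> simp [one_cons]

theorem map_pow (φ : B →+* B') (F : SeqFun g B) (n : ℕ) : (F ^ n).map φ = F.map φ ^ n := by
  induction n with
  | zero => simpa using map_one φ
  | succ n ih => rw [pow_succ, map_mul, ih, pow_succ]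

theorem eps_comap (ρ : g → g') (F : SeqFun g' B) : (F.comap ρ).eps = F.eps.comap ρ := by
  ext l; simp [eps_apply]

/-- Shuffles move positions of a sequence and ignore its entries, so `ρ` may be any function; no
linearity is involved. -/
theorem comap_mul (ρ : g → g') (F G : SeqFun g' B) :
    (F * G).comap ρ = F.comap ρ * G.comap ρ := by
  ext l
  induction l generalizing F G with
  | nil => simp
  | cons x l ih =>
    have h1 := ih (F.contr (ρ x)) G
    have h2 := ih F.eps (G.contr (ρ x))
    simp only [comap_apply] at h1 h2
    simp only [apply_cons, comap_apply, contr_mul, add_apply, contr_comap,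
      eps_comap, h1, h2]

theorem comap_pow (ρ : g → g') (F : SeqFun g' B) (n : ℕ) :
    (F ^ n).comap ρ = F.comap ρ ^ n := by
  induction n with
  | zero =>
    rw [pow_zero, pow_zero]
    ext l
    cases l <;> simp [one_cons]
  | succ n ih => rw [pow_succ, comap_mul, ih, pow_succ]

/-- Each of the `n` factors has to receive at least one argument, because its component of degree
`0` vanishes. -/
theorem pow_apply_of_length_lt {F : SeqFun g B} (hF : F [] = 0) (n : ℕ) (l : List g)
    (hl : l.length < n) : (F ^ n) l = 0 := by
  induction n generalizing l with
  | zero => simp at hl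
  | succ n ih =>
    rw [pow_succ, mul_apply]
    refine List.sum_eq_zero fun b hb => ?_
    obtain ⟨s, hs, rfl⟩ := List.mem_map.mp hb
    have := shuffles_length l s hs
    by_cases h : s.2.1.length < n
    · rw [ih _ h]; simp
    · rw [List.eq_nil_of_length_eq_zero (by omega : s.2.2.length = 0), hF]; simp

/-- Graded commutativity of the exterior product up to an additive map `τ` of the coefficients. -/
theorem graded_comm [AddCommGroup C] (τ : B →+ C) (F G : SeqFun g B)
    (h : ∀ l l', τ (F l * G l') = τ (G l' * F l)) (l : List g) :
    (G.eps = G → τ ((F * G) l) = τ ((G * F) l)) ∧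
      (G.eps = -G → τ ((F * G) l) = τ ((G * F.eps) l)) := by
  -- Contraction reverses the parity of `G`, so the even and the odd case are proved together: the
  -- term with `G.contr x` in one case is an instance of the other.
  induction l generalizing F G with
  | nil => simp [h]
  | cons x l ih =>
    have h1 : ∀ l l', τ (F.contr x l * G l') = τ (G l' * F.contr x l) := fun l l' => h (x :: l) l'
    have h2 : ∀ l l', τ (F.eps l * G.contr x l') = τ (G.contr x l' * F.eps l) := fun l l' => by
      simp only [eps_apply, smul_mul_assoc, mul_smul_comm, map_zsmul]
      rw [show τ (F l * G.contr x l') = _ from h l (x :: l')]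
      rfl
    obtain ⟨a1, a2⟩ := ih _ _ h1
    obtain ⟨b1, b2⟩ := ih _ _ h2
    constructor
    · intro hG
      have hx : (G.contr x).eps = -G.contr x := by
        rw [← neg_eq_iff_eq_neg, ← contr_eps, hG]
      simp only [apply_cons, contr_mul, add_apply, map_add, a1 hG, b2 hx, eps_eps, hG]
      abel
    · intro hG
      have hx : (G.contr x).eps = G.contr x := by
        rw [← neg_inj, ← contr_eps, hG, contr_neg]
      simp only [apply_cons, contr_mul, add_apply, map_add, a2 hG, b1 hx, hG, contr_eps, neg_mul_neg]
      abel

theorem eps_pow_of_eps_eq {F : SeqFun g B} (hF : F.eps = F) (n : ℕ) : (F ^ n).eps = F ^ n := by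
  induction n with
  | zero => simp
  | succ n ih => rw [pow_succ, eps_mul, ih, hF]

end Ring
end SeqFun

theorem IsAltSeq.pow {A g B : Type*} [CommRing A] [AddCommGroup g] [Module A g] [Ring B]
    [Algebra A B] {F : SeqFun g B} (hF : IsAltSeq A F) (n : ℕ) : IsAltSeq A (F ^ n) := by
  induction n with
  | zero => simpa using IsAltSeq.one
  | succ n ih => rw [pow_succ]; exact ih.mul hF

/-- Alternating forms on a free module vanish in degrees above its rank. -/
theorem IsAltSeq.eq_zero_of_card_lt {A E B ι : Type*} [CommRing A] [AddCommGroup E] [Module A E]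
    [AddCommGroup B] [Module A B] [Fintype ι] (b : Module.Basis ι A E) {F : SeqFun E B}
    (hF : IsAltSeq A F) (l : List E) (hl : Fintype.card ι < l.length) : F l = 0 := by
  obtain ⟨f, hf⟩ := isAlternating_iff.2 hF l.length
  have h : f = 0 := b.ext_alternating fun v hv => absurd (Fintype.card_le_of_injective v hv) (by
    simpa using hl)
  have := hf l.get
  rwa [List.ofFn_get, h] at this

/-! ### The connection on endomorphisms -/

section

variable {k A g W : Type*} [CommRing k] [CommRing A] [Algebra k A] [LieRing g] [LieAlgebra k g]
  [Module A g] [LieRingModule g A] [LieRinehartRing A g] [LieRinehartAlgebra k A g]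
  [AddCommGroup W] [Module k W] [Module A W] [IsScalarTower k A W]

namespace Connection

/-- The connection `φ ↦ [∇_δ, φ]` on `End_A(W)`. -/
def endo (D : Connection k A g W) : Connection k A g (Module.End A W) where
  toLin :=
    { toFun := fun δ =>
        { toFun := fun φ =>
            { toFun := fun w => D δ (φ w) - φ (D δ w)
              map_add' := fun v w => by simp only [map_add]; abel
              map_smul' := fun a w => by
                simp only [map_smul, D.leibniz, map_add, RingHom.id_apply, smul_sub]; abel }
          map_add' := fun φ ψ => by ext w; simp; abel
          map_smul' := fun c φ => by
            ext w
            simp [smul_sub] }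
      map_add' := fun δ η => by ext φ w; simp; abel
      map_smul' := fun a δ => by ext φ w; simp [smul_sub] }
  leibniz δ a φ := by ext w; simp [D.leibniz, smul_sub]; abel

variable (D : Connection k A g W)

@[simp] theorem endo_apply_apply (δ : g) (φ : Module.End A W) (w : W) :
    D.endo δ φ w = D δ (φ w) - φ (D δ w) := rfl

theorem endo_mul (δ : g) (φ ψ : Module.End A W) :
    D.endo δ (φ * ψ) = D.endo δ φ * ψ + φ * D.endo δ ψ := by
  ext w; simp

theorem curvSeq_pair (δ η : g) : D.curvSeq [δ, η] = D.curv δ η := rfl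

theorem curvSeq_of_length_ne (l : List g) (hl : l.length ≠ 2) : D.curvSeq l = 0 := by
  match l, hl with
  | [], _ => rfl
  | [_], _ => rfl
  | _ :: _ :: _ :: _, _ => rfl

theorem isAltSeq_curvSeq : IsAltSeq A D.curvSeq := (mem_cochains.1 D.curvForm.2).2

theorem eps_curvSeq : D.curvSeq.eps = D.curvSeq := by
  ext1 l
  by_cases hl : l.length = 2
  · simp [SeqFun.eps_apply, hl]
  · simp [SeqFun.eps_apply, D.curvSeq_of_length_ne l hl]

/-- With this, an identity between families concentrated in a single degree only has to be checked
on sequences of the one relevant length. -/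
theorem diff_apply_eq_zero {W : Type*} [AddCommGroup W] [Module k W] [Module A W]
    [IsScalarTower k A W] (D : Connection k A g W) (F : SeqFun g W) (p : ℕ)
    (hF : ∀ l : List g, l.length ≠ p → F l = 0) (l : List g) (hl : l.length ≠ p + 1) :
    D.diff F l = 0 := by
  have h1 : ∀ i : Fin l.length, F (l.eraseIdx i) = 0 := fun i => hF _ (by
    rw [List.length_eraseIdx_of_lt i.2]; have := i.2; omega)
  have h2 : ∀ (y : g) (i j : Fin l.length), i < j → F (y :: (l.eraseIdx j).eraseIdx i) = 0 :=
    fun y i j hij => hF _ (by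
      have := i.2; have := j.2
      have hij' : (i : ℕ) < j := hij
      rw [List.length_cons, List.length_eraseIdx_of_lt, List.length_eraseIdx_of_lt j.2]
      · omega
      · rw [List.length_eraseIdx_of_lt j.2]; omega)
  have h3 : ∀ i j : Fin l.length, (if i < j then (-1 : ℤ) ^ (i + j : ℕ) •
      F (⁅l[i], l[j]⁆ :: (l.eraseIdx j).eraseIdx i) else 0) = 0 := fun i j => by
    split
    · rw [h2 _ _ _ ‹_›, smul_zero]
    · rfl
  rw [diff_apply]
  simp only [h1, h3]
  simp

/-- The differential of a form of degree `1`. -/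
theorem diff_pair {F : SeqFun g W} (hF : IsAltSeq A F) (x y : g) :
    D.diff F [x, y] = D x (F [y]) - D y (F [x]) - F [⁅x, y⁆] := by
  -- Cartan's formula `ι_x d = L_x - d ι_x` lowers the degree by one.
  have h := DFunLike.congr_fun (D.contr_diff hF x) [y]
  rw [← SeqFun.apply_cons, SeqFun.sub_apply, diff_singleton, lieD_apply] at h
  rw [h]
  simp only [sum_cons]
  simp [← SeqFun.apply_cons]
  abel

/-- The differential of a form of degree `2`. -/
theorem diff_triple {F : SeqFun g W} (hF : IsAltSeq A F) (x y z : g) :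
    D.diff F [x, y, z] = D x (F [y, z]) - D y (F [x, z]) + D z (F [x, y]) - F [⁅x, y⁆, z]
      - F [y, ⁅x, z⁆] + F [x, ⁅y, z⁆] := by
  have h := DFunLike.congr_fun (D.contr_diff hF x) [y, z]
  rw [← SeqFun.apply_cons, SeqFun.sub_apply, D.diff_pair (hF.contr x), lieD_apply] at h
  rw [h]
  simp only [sum_cons]
  simp [← SeqFun.apply_cons]
  abel

/-- The Bianchi identity. -/
theorem diff_curvSeq : D.endo.diff D.curvSeq = 0 := by
  ext1 l
  by_cases hl : l.length = 3
  · obtain ⟨x, y, z, rfl⟩ := List.length_eq_three.1 hl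
    rw [diff_triple _ D.isAltSeq_curvSeq]
    ext w
    -- The Jacobi identity removes the iterated brackets; all other terms cancel formally.
    have e : ⁅⁅x, y⁆, z⁆ = ⁅x, ⁅y, z⁆⁆ - ⁅y, ⁅x, z⁆⁆ := lie_lie x y z
    simp [curvSeq_pair, curv, e]
    abel
  · exact D.endo.diff_apply_eq_zero _ 2 D.curvSeq_of_length_ne l hl

/-- The commutator connection need not be flat, so `d ∘ d = 0` is not available; the product rule
and the Bianchi identity suffice. The unit is closed because the identity commutes with `∇_δ`. -/
theorem diff_curvSeq_pow (n : ℕ) : D.endo.diff (D.curvSeq ^ n) = 0 := by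
  induction n with
  | zero =>
    ext1 l
    match l with
    | [] => simp
    | [x] => rw [diff_singleton]; ext w; simp
    | x :: y :: l =>
      refine D.endo.diff_apply_eq_zero _ 0 (fun l hl => ?_) _ (by simp)
      obtain ⟨x, l, rfl⟩ := List.exists_cons_of_length_pos (Nat.pos_of_ne_zero hl)
      simp [SeqFun.apply_cons]
  | succ n ih =>
    rw [pow_succ, diff_mul _ D.endo_mul (D.isAltSeq_curvSeq.pow n) D.isAltSeq_curvSeq, ih,
      diff_curvSeq, zero_mul, mul_zero, add_zero]

/-- A map of the coefficients that is compatible with the connections commutes with the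
differentials. -/
theorem map_diff {V : Type*} [AddCommGroup V] [Module k V] [Module A V] [IsScalarTower k A V]
    (D' : Connection k A g V) (φ : W →+ V) (h : ∀ (δ : g) (w : W), φ (D δ w) = D' δ (φ w))
    (F : SeqFun g W) : (D.diff F).map φ = D'.diff (F.map φ) := by
  ext l
  simp only [SeqFun.map_apply, diff_apply, map_add, map_sum, map_zsmul, h, apply_ite φ, map_zero]

end Connection
end

/-! ### Properties of the trace -/

section Trace

variable {A W V : Type*} [CommRing A] [AddCommGroup W] [Module A W] [Module.Finite A W]
  [Module.Projective A W] [AddCommGroup V] [Module A V] [Module.Finite A V] [Module.Projective A V]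

theorem projTrace_dualTensorHom (x : TensorProduct A (Module.Dual A W) W) :
    projTrace A W (dualTensorHom A W W x) = contractLeft A W x := by
  rw [projTrace, LinearMap.comp_apply, LinearEquiv.coe_coe]
  congr 1
  exact (dualTensorHomEquiv A W W).symm_apply_apply x

/-- Together with `end_induction` this is the working description of the trace: it is additive and
sends `v ↦ f(v) w` to `f(w)`. -/
theorem projTrace_toSpanSingleton_comp (f : Module.Dual A W) (w : W) :
    projTrace A W (LinearMap.toSpanSingleton A W w ∘ₗ f) = f w := by
  have h : LinearMap.toSpanSingleton A W w ∘ₗ f = dualTensorHom A W W (f ⊗ₜ w) := by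
    ext v; simp
  rw [h, projTrace_dualTensorHom, contractLeft_apply]

/-- The endomorphisms of a finite projective module are sums of endomorphisms of rank one. -/
theorem end_induction {P : Module.End A W → Prop}
    (h : ∀ (f : Module.Dual A W) (w : W), P (LinearMap.toSpanSingleton A W w ∘ₗ f))
    (hadd : ∀ φ ψ, P φ → P ψ → P (φ + ψ)) (φ : Module.End A W) : P φ := by
  obtain ⟨x, rfl⟩ := (dualTensorHomEquiv A W W).surjective φ
  change P (dualTensorHom A W W x)
  have h' : ∀ (f : Module.Dual A W) (w : W), P (dualTensorHom A W W (f ⊗ₜ w)) := fun f w => by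
    have e : LinearMap.toSpanSingleton A W w ∘ₗ f = dualTensorHom A W W (f ⊗ₜ w) := by
      ext v; simp
    rw [← e]; exact h f w
  induction x with
  | zero => simpa using h' 0 0
  | tmul f w => exact h' f w
  | add x y hx hy => rw [map_add]; exact hadd _ _ hx hy

theorem projTrace_mul_comm (φ ψ : Module.End A W) :
    projTrace A W (φ * ψ) = projTrace A W (ψ * φ) := by
  induction φ using end_induction with
  | h f w =>
    have e1 : (LinearMap.toSpanSingleton A W w ∘ₗ f) * ψ =
        LinearMap.toSpanSingleton A W w ∘ₗ (f ∘ₗ ψ) := rfl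
    have e2 : ψ * (LinearMap.toSpanSingleton A W w ∘ₗ f) =
        LinearMap.toSpanSingleton A W (ψ w) ∘ₗ f := by ext; simp
    rw [e1, e2, projTrace_toSpanSingleton_comp, projTrace_toSpanSingleton_comp]; rfl
  | hadd φ φ' h h' => rw [add_mul, mul_add, map_add, map_add, h, h']

/-- Cyclicity between two different modules. The hypothesis `hχ` holds whenever `ψ φ = 1`, which
covers both conjugation by an isomorphism and the inclusion of a direct summand. -/
theorem projTrace_comp_comm (φ : W →ₗ[A] V) (ψ : V →ₗ[A] W) (χ : Module.End A W)
    (hχ : χ ∘ₗ (ψ ∘ₗ φ) = χ) : projTrace A V (φ ∘ₗ χ ∘ₗ ψ) = projTrace A W χ := by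
  have h : ∀ χ : Module.End A W, projTrace A V (φ ∘ₗ χ ∘ₗ ψ) = projTrace A W (χ ∘ₗ (ψ ∘ₗ φ)) := by
    intro χ
    induction χ using end_induction with
    | h f w =>
      have e1 : φ ∘ₗ (LinearMap.toSpanSingleton A W w ∘ₗ f) ∘ₗ ψ =
          LinearMap.toSpanSingleton A V (φ w) ∘ₗ (f ∘ₗ ψ) := by ext; simp
      have e2 : (LinearMap.toSpanSingleton A W w ∘ₗ f) ∘ₗ (ψ ∘ₗ φ) =
          LinearMap.toSpanSingleton A W w ∘ₗ (f ∘ₗ ψ ∘ₗ φ) := rfl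
      rw [e1, e2, projTrace_toSpanSingleton_comp, projTrace_toSpanSingleton_comp]; rfl
    | hadd φ φ' h h' =>
      rw [LinearMap.add_comp, LinearMap.comp_add, map_add, LinearMap.add_comp, map_add, h, h']
  rw [h, hχ]

theorem projTrace_prodMap (φ : Module.End A W) (ψ : Module.End A V) :
    projTrace A (W × V) (φ.prodMap ψ) = projTrace A W φ + projTrace A V ψ := by
  have e : φ.prodMap ψ = LinearMap.inl A W V ∘ₗ φ ∘ₗ LinearMap.fst A W V +
      LinearMap.inr A W V ∘ₗ ψ ∘ₗ LinearMap.snd A W V := by ext <;> simp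
  rw [e, map_add, projTrace_comp_comm, projTrace_comp_comm]
  · ext; simp
  · ext; simp

open TensorProduct in
theorem projTrace_tensorMap (φ : Module.End A W) (ψ : Module.End A V) :
    projTrace A (W ⊗[A] V) (TensorProduct.map φ ψ) = projTrace A W φ * projTrace A V ψ := by
  induction φ using end_induction with
  | h f w =>
    induction ψ using end_induction with
    | h f' v =>
      have e : TensorProduct.map (LinearMap.toSpanSingleton A W w ∘ₗ f)
          (LinearMap.toSpanSingleton A V v ∘ₗ f') =
          LinearMap.toSpanSingleton A (W ⊗[A] V) (w ⊗ₜ v) ∘ₗ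
            (LinearMap.mul' A A ∘ₗ TensorProduct.map f f') := by
        -- A tensor product of maps of rank one has rank one, with vector `w ⊗ v` and functional `x
        -- ⊗ y ↦ f(x) f'(y)`.
        ext x y
        simp [smul_tmul', smul_smul, mul_comm]
      rw [e, projTrace_toSpanSingleton_comp, projTrace_toSpanSingleton_comp,
        projTrace_toSpanSingleton_comp]
      simp
    | hadd ψ ψ' h h' => rw [TensorProduct.map_add_right, map_add, map_add, mul_add, h, h']
  | hadd φ φ' h h' => rw [TensorProduct.map_add_left, map_add, map_add, add_mul, h, h']

theorem projTrace_self (φ : Module.End A A) : projTrace A A φ = φ 1 := by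
  have e : φ = LinearMap.toSpanSingleton A A 1 ∘ₗ φ := by ext; simp
  conv_lhs => rw [e]
  rw [projTrace_toSpanSingleton_comp]

end Trace

/-! ### The trace of forms, and closedness of `tr(R^n)` -/

section

variable {k A g W : Type*} [CommRing k] [CommRing A] [Algebra k A] [LieRing g] [LieAlgebra k g]
  [Module A g] [LieRingModule g A] [LieRinehartRing A g] [LieRinehartAlgebra k A g]
  [AddCommGroup W] [Module k W] [Module A W] [IsScalarTower k A W] [Module.Finite A W]
  [Module.Projective A W]

/-- The trace `End_A(W) → A` is compatible with the connections. -/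
theorem projTrace_endo (D : Connection k A g W) (δ : g) (φ : Module.End A W) :
    projTrace A W (D.endo δ φ) = ⁅δ, projTrace A W φ⁆ := by
  induction φ using end_induction with
  | h f w =>
    -- The dual connection applied to `f`. Then `[∇_δ, w ⊗ f] = ∇_δ w ⊗ f + w ⊗ f'`, and the two
    -- terms `f(∇_δ w)` cancel in the trace.
    let f' : Module.Dual A W :=
      { toFun := fun v => ⁅δ, f v⁆ - f (D δ v)
        map_add' := fun v v' => by simp only [map_add, lie_add]; abel
        map_smul' := fun a v => by
          simp [D.leibniz, mul_sub] }
    have e : D.endo δ (LinearMap.toSpanSingleton A W w ∘ₗ f) =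
        LinearMap.toSpanSingleton A W (D δ w) ∘ₗ f + LinearMap.toSpanSingleton A W w ∘ₗ f' := by
      ext v
      simp [f', D.leibniz, sub_smul]
      abel
    rw [e, map_add, projTrace_toSpanSingleton_comp, projTrace_toSpanSingleton_comp,
      projTrace_toSpanSingleton_comp]
    simp [f']
  | hadd φ φ' h h' => rw [map_add, map_add, map_add, lie_add, h, h']

/-- `d(tr F) = tr(∇ F)`. -/
theorem canonical_diff_projTrace (D : Connection k A g W) (F : SeqFun g (Module.End A W)) :
    (Connection.canonical k A g).diff (F.map (projTrace A W)) =
      (D.endo.diff F).map (projTrace A W) :=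
  (D.endo.map_diff (Connection.canonical k A g) (projTrace A W).toAddMonoidHom
    (fun δ φ => projTrace_endo D δ φ) F).symm

/-- `tr(F ∧ G) = tr(G ∧ F)` if `G` has even degree. -/
theorem projTrace_mul_comm_of_eps {G : SeqFun g (Module.End A W)} (hG : G.eps = G)
    (F : SeqFun g (Module.End A W)) :
    (F * G).map (projTrace A W) = (G * F).map (projTrace A W) := by
  ext l
  exact (SeqFun.graded_comm (projTrace A W).toAddMonoidHom F G
    (fun _ _ => projTrace_mul_comm _ _) l).1 hG

theorem d_mapCochains_curvForm_pow (D : Connection k A g W) (n : ℕ) :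
    d k A g (mapCochains (projTrace A W) (D.curvForm ^ n)) = 0 := by
  apply Subtype.ext
  have e : ((D.curvForm ^ n : cochains A g (Module.End A W)) : SeqFun g _) = D.curvSeq ^ n := rfl
  change (Connection.canonical k A g).diff (SeqFun.map _ (D.curvForm ^ n).1) = 0
  rw [e, canonical_diff_projTrace D, D.diff_curvSeq_pow]
  ext l
  simp

end

/-! ### Polynomial functions -/

section Polynomial
open Polynomial

/-- The expansion at `0` shows that `f` is a polynomial function, and the linear coefficient of its
expansion at `s` is the derivative at `s`. As `k` is infinite, the derivative vanishes as a
polynomial, so `f` is constant in characteristic zero. -/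
theorem eval_eq_eval_of_forall_coeff_one_eq_zero {k : Type*} [Field k] [CharZero k] (f : k → k)
    (hf : ∀ s, ∃ p : k[X], (∀ h, f (s + h) = p.eval h) ∧ p.coeff 1 = 0) (s t : k) :
    f s = f t := by
  obtain ⟨p, hp, -⟩ := hf 0
  simp only [zero_add] at hp
  have hd : derivative p = 0 := by
    refine Polynomial.funext fun s => ?_
    obtain ⟨q, hq, hq1⟩ := hf s
    have e : q = p.comp (X + C s) := Polynomial.funext fun h => by
      rw [← hq, hp, eval_comp]; simp [add_comm]
    have h1 : (derivative q).coeff 0 = 0 := by rw [coeff_derivative, hq1]; simp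
    rw [e, derivative_comp, coeff_zero_eq_eval_zero] at h1
    simpa [eval_comp] using h1
  rw [hp, hp, eq_C_of_natDegree_eq_zero (derivative_eq_zero.1 hd)]
  simp

/-- The power is expanded in `S[X]`, where `X` is central although `a`, `b`, `c` need not commute;
hence the linear coefficient keeps `b` between powers of `a`. Then `Λ` is applied to each
coefficient. -/
theorem exists_polynomial_eval_eq {k S : Type*} [CommRing k] [Ring S] [Algebra k S]
    (Λ : S →ₗ[k] k) (a b c : S) (n : ℕ) :
    ∃ p : k[X], (∀ s, p.eval s = Λ ((a + s • b + s ^ 2 • c) ^ n)) ∧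
      p.coeff 1 = Λ (∑ i ∈ Finset.range n, a ^ i * b * a ^ (n - 1 - i)) := by
  set q : S[X] := C a + C b * X + C c * X ^ 2 with hq
  have q0 : q.coeff 0 = a := by simp [hq]
  have q1 : q.coeff 1 = b := by simp [hq, coeff_C]
  have hpow0 : ∀ n, (q ^ n).coeff 0 = a ^ n := fun n => by
    induction n with
    | zero => simp
    | succ n ih => rw [pow_succ, mul_coeff_zero, ih, q0, pow_succ]
  have hpow1 : ∀ n, (q ^ n).coeff 1 =
      ∑ i ∈ Finset.range n, a ^ i * b * a ^ (n - 1 - i) := fun n => by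
    induction n with
    | zero => simp [coeff_one]
    | succ n ih =>
      rw [pow_succ, mul_coeff_one, ih, hpow0, q0, q1, Finset.sum_range_succ, Finset.sum_mul,
        add_comm]
      congr 1
      · refine Finset.sum_congr rfl fun i hi => ?_
        rw [Finset.mem_range] at hi
        rw [mul_assoc, ← pow_succ]
        congr 2; omega
      · simp
  -- Evaluation at `s` is multiplicative over the noncommutative ring `S` because scalars from `k`
  -- are central in `S`.
  let ev : k → (S[X] →+* S) := fun s =>
    eval₂RingHom' (RingHom.id S) (algebraMap k S s) fun x => (Algebra.commutes s x).symm
  refine ⟨∑ i ∈ (q ^ n).support, monomial i (Λ ((q ^ n).coeff i)), fun s => ?_, ?_⟩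
  · have e : a + s • b + s ^ 2 • c = ev s q := by
      have hC : ∀ x, ev s (C x) = x := fun x => eval₂_C _ _
      have hX : ev s X = algebraMap k S s := eval₂_X _ _
      rw [hq, map_add, map_add, map_mul, map_mul, map_pow, hC, hC, hC, hX, ← map_pow,
        ← Algebra.commutes, ← Algebra.commutes, ← Algebra.smul_def, ← Algebra.smul_def]
    rw [e, ← map_pow, eval_finsetSum]
    change _ = Λ (eval₂ (RingHom.id S) (algebraMap k S s) (q ^ n))
    rw [eval₂_eq_sum, Polynomial.sum_def, map_sum]
    refine Finset.sum_congr rfl fun i _ => ?_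
    rw [eval_monomial, RingHom.id_apply, ← map_pow, ← Algebra.commutes, ← Algebra.smul_def,
      map_smul, smul_eq_mul, mul_comm]
  · rw [← hpow1, finsetSum_coeff]
    simp only [coeff_monomial]
    rw [Finset.sum_ite_eq']
    split
    · rfl
    · rename_i h; rw [notMem_support_iff.1 h, map_zero]

end Polynomial

/-! ### Change of the connection -/

/-- A linear map as a form of degree `1`. -/
def SeqFun.ofLinear {A g B : Type*} [CommRing A] [AddCommGroup g] [Module A g] [AddCommGroup B]
    [Module A B] (θ : g →ₗ[A] B) : SeqFun g B :=
  ⟨fun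
    | [x] => θ x
    | _ => 0⟩

section OfLinear

variable {A g B : Type*} [CommRing A] [AddCommGroup g] [Module A g] [AddCommGroup B] [Module A B]
  (θ : g →ₗ[A] B)

@[simp] theorem SeqFun.ofLinear_singleton (x : g) : ofLinear θ [x] = θ x := rfl

theorem SeqFun.ofLinear_of_length_ne (l : List g) (hl : l.length ≠ 1) : ofLinear θ l = 0 := by
  match l, hl with
  | [], _ => rfl
  | _ :: _ :: _, _ => rfl

theorem isAltSeq_ofLinear : IsAltSeq A (SeqFun.ofLinear θ) where
  add l₁ x y l₂ := by
    match l₁, l₂ with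
    | [], [] => exact map_add θ x y
    | [], _ :: _ => exact (add_zero _).symm
    | [_], _ => exact (add_zero _).symm
    | _ :: _ :: _, _ => exact (add_zero _).symm
  smul l₁ a x l₂ := by
    match l₁, l₂ with
    | [], [] => exact map_smul θ a x
    | [], _ :: _ => exact (smul_zero _).symm
    | [_], _ => exact (smul_zero _).symm
    | _ :: _ :: _, _ => exact (smul_zero _).symm
  alt l₁ x l₂ := by
    match l₁ with
    | [] => rfl
    | [_] => rfl
    | _ :: _ :: _ => rfl

theorem isBounded_ofLinear : IsBounded (SeqFun.ofLinear θ) :=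
  ⟨2, fun l hl => SeqFun.ofLinear_of_length_ne θ l (by omega)⟩

end OfLinear

theorem SeqFun.mul_pair {g B : Type*} [Ring B] (F G : SeqFun g B) (x y : g) :
    (F * G) [x, y] = F [x, y] * G [] + F [x] * G [y] - F [y] * G [x] + F [] * G [x, y] := by
  simp [mul_apply, shuffles]
  abel

theorem ofLinear_mul_ofLinear_of_length_ne {A g B : Type*} [CommRing A] [AddCommGroup g]
    [Module A g] [Ring B] [Algebra A B] (θ η : g →ₗ[A] B) (l : List g) (hl : l.length ≠ 2) :
    (SeqFun.ofLinear θ * SeqFun.ofLinear η) l = 0 := by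
  rw [SeqFun.mul_apply]
  refine List.sum_eq_zero fun b hb => ?_
  obtain ⟨s, hs, rfl⟩ := List.mem_map.mp hb
  have := shuffles_length l s hs
  by_cases h : s.2.1.length = 1
  · rw [SeqFun.ofLinear_of_length_ne η s.2.2 (by omega)]; simp
  · rw [SeqFun.ofLinear_of_length_ne θ _ h]; simp

/-- For `η = θ` the value is the commutator `[θ x, θ y]`, so the square of a form of degree `1` need
not vanish. -/
theorem ofLinear_mul_ofLinear_pair {A g B : Type*} [CommRing A] [AddCommGroup g]
    [Module A g] [Ring B] [Algebra A B] (θ η : g →ₗ[A] B) (x y : g) :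
    (SeqFun.ofLinear θ * SeqFun.ofLinear η) [x, y] = θ x * η y - θ y * η x := by
  rw [SeqFun.mul_pair]
  simp [SeqFun.ofLinear_of_length_ne]

section

variable {k A g W : Type*} [CommRing k] [CommRing A] [Algebra k A] [LieRing g] [LieAlgebra k g]
  [Module A g] [LieRingModule g A] [LieRinehartRing A g] [LieRinehartAlgebra k A g]
  [AddCommGroup W] [Module k W] [Module A W] [IsScalarTower k A W]

namespace Connection

/-- The connection `∇ + θ`. -/
def translate (D : Connection k A g W) (θ : g →ₗ[A] Module.End A W) : Connection k A g W where
  toLin :=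
    { toFun := fun δ => D δ + (θ δ).restrictScalars k
      map_add' := fun δ η => by ext w; simp; abel
      map_smul' := fun a δ => by ext w; simp }
  leibniz δ a w := by simp [D.leibniz]; abel

@[simp] theorem translate_apply (D : Connection k A g W) (θ : g →ₗ[A] Module.End A W) (δ : g)
    (w : W) : D.translate θ δ w = D δ w + θ δ w := rfl

theorem ext_apply {D D' : Connection k A g W} (h : ∀ δ w, D δ w = D' δ w) : D = D' := by
  obtain ⟨L, _⟩ := D
  obtain ⟨L', _⟩ := D'
  obtain rfl : L = L' := by ext δ w; exact h δ w
  rfl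

/-- The difference `∇' - ∇` of two connections. -/
def difference (D D' : Connection k A g W) : g →ₗ[A] Module.End A W where
  toFun δ :=
    { toFun := fun w => D' δ w - D δ w
      map_add' := fun v w => by simp only [map_add]; abel
      map_smul' := fun a w => by simp [D.leibniz, D'.leibniz, smul_sub] }
  map_add' δ η := by ext w; simp; abel
  map_smul' a δ := by ext w; simp [smul_sub]

theorem translate_difference (D D' : Connection k A g W) :
    D.translate (D.difference D') = D' :=
  ext_apply fun δ w => by simp [difference]

/-- In `[∇_x + θ_x, ∇_y + θ_y]` the mixed terms give `d_∇ θ` and the quadratic term gives `θ ∧ θ`;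
the degree is `2` on both sides. -/
theorem curvSeq_translate (D : Connection k A g W) (θ : g →ₗ[A] Module.End A W) :
    (D.translate θ).curvSeq =
      D.curvSeq + D.endo.diff (SeqFun.ofLinear θ) + SeqFun.ofLinear θ * SeqFun.ofLinear θ := by
  ext1 l
  by_cases hl : l.length = 2
  · obtain ⟨x, y, rfl⟩ := List.length_eq_two.1 hl
    rw [SeqFun.add_apply, SeqFun.add_apply, ofLinear_mul_ofLinear_pair,
      diff_pair _ (isAltSeq_ofLinear θ)]
    ext w
    simp [curvSeq_pair, curv]
    abel
  · rw [SeqFun.add_apply, SeqFun.add_apply, ofLinear_mul_ofLinear_of_length_ne _ _ _ hl,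
      curvSeq_of_length_ne _ _ hl, curvSeq_of_length_ne _ _ hl,
      diff_apply_eq_zero _ _ 1 (SeqFun.ofLinear_of_length_ne θ) _ hl]
    simp

theorem ofLinear_smul (s : k) (θ : g →ₗ[A] Module.End A W) :
    SeqFun.ofLinear (s • θ) = s • SeqFun.ofLinear θ := by
  ext1 l
  match l with
  | [] => exact (smul_zero s).symm
  | [x] => rfl
  | _ :: _ :: _ => exact (smul_zero s).symm

/-- The expansion is centred at `∇ + sθ` so that the linear term involves the differential of that
same connection, for which the Bianchi identity holds. -/
theorem curvSeq_translate_smul (D : Connection k A g W) (θ : g →ₗ[A] Module.End A W) (s h : k) :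
    (D.translate ((s + h) • θ)).curvSeq =
      (D.translate (s • θ)).curvSeq + h • (D.translate (s • θ)).endo.diff (SeqFun.ofLinear θ) +
        h ^ 2 • (SeqFun.ofLinear θ * SeqFun.ofLinear θ) := by
  have e : D.translate ((s + h) • θ) = (D.translate (s • θ)).translate (h • θ) :=
    ext_apply fun δ w => by simp [add_smul, add_assoc]
  rw [e, curvSeq_translate, ofLinear_smul, diff_smul, smul_mul_smul_comm, sq]

variable [Module.Finite A W] [Module.Projective A W]

/-- The product rule has a second term containing `d_∇(R^n)`, which vanishes. What remains exhibits
the derivative of the trace form along the line of connections as exact. -/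
theorem canonical_diff_transgression (D : Connection k A g W) (θ : g →ₗ[A] Module.End A W)
    (n : ℕ) : (canonical k A g).diff
      ((SeqFun.ofLinear θ * D.curvSeq ^ n).map (projTrace A W)) =
        (D.endo.diff (SeqFun.ofLinear θ) * D.curvSeq ^ n).map (projTrace A W) := by
  rw [canonical_diff_projTrace D,
    diff_mul _ D.endo_mul (isAltSeq_ofLinear θ) (D.isAltSeq_curvSeq.pow n), D.diff_curvSeq_pow,
    mul_zero, add_zero]

/-- `R^i` has even degree, so it moves cyclically under the trace without a sign. -/
theorem projTrace_pow_mul_pow (D : Connection k A g W) (F : SeqFun g (Module.End A W))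
    (i j : ℕ) : (D.curvSeq ^ i * F * D.curvSeq ^ j).map (projTrace A W) =
      (F * D.curvSeq ^ (i + j)).map (projTrace A W) := by
  rw [mul_assoc, ← projTrace_mul_comm_of_eps (SeqFun.eps_pow_of_eps_eq D.eps_curvSeq i), mul_assoc,
    ← pow_add, add_comm]

end Connection
end

/-! ### Independence of the class from the connection -/

section

variable {k A g W : Type*} [Field k] [CharZero k] [CommRing A] [Algebra k A] [LieRing g]
  [LieAlgebra k g] [Module A g] [LieRingModule g A] [LieRinehartRing A g]
  [LieRinehartAlgebra k A g] [AddCommGroup W] [Module k W] [Module A W] [IsScalarTower k A W]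
  [Module.Finite A W] [Module.Projective A W]

/-- The submodule of coboundaries. -/
def boundarySubmodule (k A g : Type*) [Field k] [CommRing A] [Algebra k A] [LieRing g]
    [LieAlgebra k g] [Module A g] [LieRingModule g A] [LieRinehartRing A g]
    [LieRinehartAlgebra k A g] : Submodule k (SeqFun g A) where
  carrier := {G | ∃ F : cochains A g A, (d k A g F).1 = G}
  zero_mem' := ⟨0, by rw [map_zero]; rfl⟩
  add_mem' := by
    rintro _ _ ⟨F, rfl⟩ ⟨G, rfl⟩
    exact ⟨F + G, by rw [map_add]; rfl⟩
  smul_mem' := by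
    rintro c _ ⟨F, rfl⟩
    exact ⟨c • F, by rw [map_smul]; rfl⟩

theorem transgression_mem_boundarySubmodule (D : Connection k A g W)
    (θ : g →ₗ[A] Module.End A W) (n : ℕ) :
    (D.endo.diff (SeqFun.ofLinear θ) * D.curvSeq ^ n).map (projTrace A W) ∈
      boundarySubmodule k A g := by
  let t : cochains A g (Module.End A W) :=
    ⟨SeqFun.ofLinear θ, mem_cochains.2 ⟨isBounded_ofLinear θ, isAltSeq_ofLinear θ⟩⟩
  exact ⟨mapCochains (projTrace A W) (t * D.curvForm ^ n), D.canonical_diff_transgression θ n⟩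

/-- The trace of forms, as a `k`-linear map. -/
noncomputable def traceSeq (k A g W : Type*) [Field k] [CommRing A] [Algebra k A]
    [AddCommGroup W] [Module k W] [Module A W] [IsScalarTower k A W]
    [Module.Finite A W] [Module.Projective A W] :
    SeqFun g (Module.End A W) →ₗ[k] SeqFun g A where
  toFun F := F.map (projTrace A W)
  map_add' F G := by ext l; simp
  map_smul' c F := by
    ext l
    exact LinearMap.map_smul_of_tower (projTrace A W) c (F l)

/-- The class of `tr(R_∇^n)` does not depend on the connection `∇`. -/
theorem exists_d_eq_sub (D D' : Connection k A g W) (n : ℕ) :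
    ∃ F, d k A g F = mapCochains (projTrace A W) (D.curvForm ^ n) -
      mapCochains (projTrace A W) (D'.curvForm ^ n) := by
  suffices h : traceSeq k A g W (D.curvSeq ^ n) - traceSeq k A g W (D'.curvSeq ^ n) ∈
      boundarySubmodule k A g by
    obtain ⟨F, hF⟩ := h
    exact ⟨F, Subtype.ext hF⟩
  -- An element outside a subspace is separated from it by a linear functional `Λ`. The
  -- contradiction will be that `Λ tr(R_s^n)` is constant along the line joining the two
  -- connections.
  by_contra hN
  obtain ⟨Λ, hΛ, hΛN⟩ := Submodule.exists_le_ker_of_notMem hN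
  let θ := D'.difference D
  have hs : ∀ s : k, ∃ p : Polynomial k, (∀ h, Λ (traceSeq k A g W
      ((D'.translate ((s + h) • θ)).curvSeq ^ n)) = p.eval h) ∧ p.coeff 1 = 0 := fun s => by
    obtain ⟨p, hp, hp1⟩ := exists_polynomial_eval_eq (Λ ∘ₗ traceSeq k A g W)
      (D'.translate (s • θ)).curvSeq ((D'.translate (s • θ)).endo.diff (SeqFun.ofLinear θ))
      (SeqFun.ofLinear θ * SeqFun.ofLinear θ) n
    refine ⟨p, fun h => ?_, ?_⟩
    · rw [hp, Connection.curvSeq_translate_smul, LinearMap.comp_apply]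
    · rw [hp1, map_sum]
      refine Finset.sum_eq_zero fun i _ => ?_
      -- Each summand `tr(R_s^i ∧ d_s θ ∧ R_s^j)` equals `tr(d_s θ ∧ R_s^{i+j})`, a coboundary, and
      -- is therefore killed by `Λ`.
      refine LinearMap.mem_ker.1 (hΛN ?_)
      change SeqFun.map _ _ ∈ _
      rw [Connection.projTrace_pow_mul_pow]
      exact transgression_mem_boundarySubmodule _ θ _
  have key := eval_eq_eval_of_forall_coeff_one_eq_zero
    (fun s : k => Λ (traceSeq k A g W ((D'.translate (s • θ)).curvSeq ^ n))) hs 1 0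
  -- The line starts at `D'` for `s = 0` and reaches `D` for `s = 1`.
  have e1 : D'.translate ((1 : k) • θ) = D := by rw [one_smul]; exact D'.translate_difference D
  have e0 : D'.translate ((0 : k) • θ) = D' :=
    Connection.ext_apply fun δ w => by simp
  simp only [e1, e0] at key
  apply hΛ
  rw [map_sub, sub_eq_zero]
  exact key

end

/-! ### A connection with nilpotent curvature -/

theorem IsAltSeq.map {A g B B' : Type*} [CommRing A] [AddCommGroup g] [Module A g]
    [AddCommGroup B] [Module A B] [AddCommGroup B'] [Module A B'] (φ : B →ₗ[A] B')
    {F : SeqFun g B} (hF : IsAltSeq A F) : IsAltSeq A (F.map φ) :=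
  ⟨by simp [hF.add], by simp [hF.smul], by simp [hF.alt]⟩

section

variable {k A g W : Type*} [CommRing k] [CommRing A] [Algebra k A] [LieRing g] [LieAlgebra k g]
  [Module A g] [LieRingModule g A] [LieRinehartRing A g] [LieRinehartAlgebra k A g]
  [AddCommGroup W] [Module k W] [Module A W] [IsScalarTower k A W]

namespace Connection

/-- The direct sum of canonical connections on a free module. -/
def canonicalPi (k A g ι : Type*) [CommRing k] [CommRing A] [Algebra k A] [LieRing g]
    [LieAlgebra k g] [Module A g] [LieRingModule g A] [LieRinehartRing A g]
    [LieRinehartAlgebra k A g] : Connection k A g (ι → A) where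
  toLin :=
    { toFun := fun δ => LinearMap.pi fun i => canonical k A g δ ∘ₗ LinearMap.proj i
      map_add' := fun δ η => by ext v i; simp
      map_smul' := fun a δ => by ext v i; simp }
  leibniz δ a v := by ext i; simp

theorem canonicalPi_apply {ι : Type*} (δ : g) (v : ι → A) (i : ι) :
    canonicalPi k A g ι δ v i = ⁅δ, v i⁆ := rfl

theorem canonicalPi_lie {ι : Type*} (δ η : g) (v : ι → A) :
    canonicalPi k A g ι ⁅δ, η⁆ v = canonicalPi k A g ι δ (canonicalPi k A g ι η v) -
      canonicalPi k A g ι η (canonicalPi k A g ι δ v) := by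
  ext i; simp [canonicalPi_apply]

/-- The connection induced on a direct summand. -/
def retract {V : Type*} [AddCommGroup V] [Module k V] [Module A V] [IsScalarTower k A V]
    (D : Connection k A g V) (p : V →ₗ[A] W) (i : W →ₗ[A] V) (h : ∀ w, p (i w) = w) :
    Connection k A g W where
  toLin :=
    { toFun := fun δ => p.restrictScalars k ∘ₗ D δ ∘ₗ i.restrictScalars k
      map_add' := fun δ η => by ext w; simp
      map_smul' := fun a δ => by ext w; simp }
  leibniz δ a w := by simp [D.leibniz, h]

@[simp] theorem retract_apply {V : Type*} [AddCommGroup V] [Module k V] [Module A V]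
    [IsScalarTower k A V] (D : Connection k A g V) (p : V →ₗ[A] W) (i : W →ₗ[A] V)
    (h : ∀ w, p (i w) = w) (δ : g) (w : W) : D.retract p i h δ w = p (D δ (i w)) := rfl

/-- The curvature of the connection induced on a direct summand of a free module is
`p (de ∧ de) i` for the idempotent `e = i p`. -/
theorem curv_retract_canonicalPi {ι : Type*} (p : (ι → A) →ₗ[A] W) (i : W →ₗ[A] (ι → A))
    (h : ∀ w, p (i w) = w) (δ η : g) (w : W) :
    ((canonicalPi k A g ι).retract p i h).curv δ η w =
      p (((canonicalPi k A g ι).endo δ (i ∘ₗ p) * (canonicalPi k A g ι).endo η (i ∘ₗ p) -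
        (canonicalPi k A g ι).endo η (i ∘ₗ p) * (canonicalPi k A g ι).endo δ (i ∘ₗ p)) (i w)) := by
  -- The canonical connection on the free module is flat, so `∇_{[δ, η]}` becomes a commutator; `p i
  -- = 1` does the rest.
  simp [curv, canonicalPi_lie, h]
  abel

/-- Every finite projective module has a connection whose curvature is nilpotent. -/
theorem exists_curvSeq_pow_eq_zero (k A g W : Type*) [CommRing k] [CommRing A] [Algebra k A]
    [LieRing g] [LieAlgebra k g] [Module A g] [LieRingModule g A] [LieRinehartRing A g]
    [LieRinehartAlgebra k A g] [AddCommGroup W] [Module k W] [Module A W] [IsScalarTower k A W]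
    [Module.Finite A W] [Module.Projective A W] :
    ∃ (D : Connection k A g W) (N : ℕ), ∀ n, N ≤ n → D.curvSeq ^ n = 0 := by
  obtain ⟨m, p, i, -, -, hpi⟩ := Module.Finite.exists_comp_eq_id_of_projective A W
  have h : ∀ w, p (i w) = w := LinearMap.congr_fun hpi
  let P := canonicalPi k A g (Fin m)
  -- The derivative `∂_δ e` of the idempotent `e = i p`. The curvature sees `δ` only through it.
  let ρ : g → Module.End A (Fin m → A) := fun δ => P.endo δ (i ∘ₗ p)
  let φ : Module.End A (Fin m → A) →ₗ[A] Module.End A W :=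
    { toFun := fun M => p ∘ₗ M ∘ₗ i
      map_add' := fun M M' => by ext; simp
      map_smul' := fun a M => by ext; simp }
  -- The tautological form of degree `1` on `End_A(A^m)`. The form `F = p (t ∧ t) i` below no longer
  -- involves `g`, and the curvature is its pullback along `ρ`.
  let t : SeqFun (Module.End A (Fin m → A)) (Module.End A (Fin m → A)) :=
    SeqFun.ofLinear (A := A) LinearMap.id
  let F : SeqFun (Module.End A (Fin m → A)) (Module.End A W) := (t * t).map φ
  have hF : IsAltSeq A F := ((isAltSeq_ofLinear _).mul (isAltSeq_ofLinear _)).map φ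
  have hR : (P.retract p i h).curvSeq = F.comap ρ := by
    ext1 l
    by_cases hl : l.length = 2
    · obtain ⟨x, y, rfl⟩ := List.length_eq_two.1 hl
      ext1 w
      change _ = φ ((t * t) [ρ x, ρ y]) w
      rw [ofLinear_mul_ofLinear_pair]
      exact curv_retract_canonicalPi p i h x y w
    · rw [curvSeq_of_length_ne _ _ hl]
      change _ = φ ((t * t) _)
      rw [ofLinear_mul_ofLinear_of_length_ne _ _ _ (by simpa using hl), map_zero]
  let b := Module.Free.chooseBasis A (Module.End A (Fin m → A))
  refine ⟨P.retract p i h,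
    Fintype.card (Module.Free.ChooseBasisIndex A (Module.End A (Fin m → A))) + 1, fun n hn => ?_⟩
  rw [hR, ← SeqFun.comap_pow]
  ext1 l
  rw [SeqFun.comap_apply, SeqFun.zero_apply]
  -- On fewer than `n` arguments `F^n` vanishes as `F` has no term of degree `0`. On at least `n`
  -- arguments the number of arguments exceeds the rank of the free module.
  rcases lt_or_ge (l.map ρ).length n with hl | hl
  · refine SeqFun.pow_apply_of_length_lt ?_ n _ hl
    change φ ((t * t) []) = 0
    rw [ofLinear_mul_ofLinear_of_length_ne _ _ _ (by simp), map_zero]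
  · exact (hF.pow n).eq_zero_of_card_lt b _ (by omega)

end Connection
end

/-! ### The Chern character of a pair -/

section

variable {k : Type*} {A : Type u} {g : Type*} [Field k] [CommRing A] [Algebra k A] [LieRing g]
  [LieAlgebra k g] [Module A g] [LieRingModule g A] [LieRinehartRing A g]
  [LieRinehartAlgebra k A g]

theorem chForm_val (V : ConnModule k A g) (n : ℕ) : (chForm V n).1 =
    (n.factorial : k)⁻¹ • (V.conn.curvSeq ^ n).map (projTrace A V.carrier) := rfl

theorem chForm_mem_cocycles (V : ConnModule k A g) (n : ℕ) : chForm V n ∈ cocycles k A g := by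
  rw [mem_cocycles, chForm, map_smul, d_mapCochains_curvForm_pow, smul_zero]

/-- The cocycle `(1/n!) tr(R_∇^n)`. -/
noncomputable def chCocycle (V : ConnModule k A g) (n : ℕ) : cocycles k A g :=
  ⟨chForm V n, chForm_mem_cocycles V n⟩

/-- The class of `(1/n!) tr(R_∇^n)`. -/
noncomputable def chClass (V : ConnModule k A g) (n : ℕ) : Cohomology k A g :=
  Cohomology.mk k A g (chCocycle V n)

theorem Cohomology.mk_eq_zero {z : cocycles k A g} (h : ∃ F, d k A g F = z.1) :
    Cohomology.mk k A g z = 0 :=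
  (RingCon.eq _).2 ((TwoSidedIdeal.mem_iff _ _).1 ((TwoSidedIdeal.mem_mk' _ _ _ _ _ _ _).2 h))

/-- The forms themselves may be nonzero in all degrees; only their classes can be computed with a
connection of nilpotent curvature. -/
theorem exists_chClass_eq_zero [CharZero k] (V : ConnModule k A g) :
    ∃ N, ∀ n, N ≤ n → chClass V n = 0 := by
  obtain ⟨D, N, hN⟩ := Connection.exists_curvSeq_pow_eq_zero k A g V.carrier
  refine ⟨N, fun n hn => Cohomology.mk_eq_zero ?_⟩
  obtain ⟨F, hF⟩ := exists_d_eq_sub V.conn D n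
  have h0 : mapCochains (projTrace A V.carrier) (D.curvForm ^ n) = 0 := by
    apply Subtype.ext
    change SeqFun.map _ (D.curvSeq ^ n) = 0
    rw [hN n hn]
    ext l
    simp
  rw [h0, sub_zero] at hF
  exact ⟨(n.factorial : k)⁻¹ • F, by rw [map_smul, hF]; rfl⟩

/-- Isomorphic pairs have the same forms `tr(R_∇^n)`. -/
theorem chForm_congr {V W : ConnModule k A g} (h : V.Iso W) (n : ℕ) : chForm V n = chForm W n := by
  obtain ⟨e, he⟩ := h
  apply Subtype.ext
  rw [chForm_val, chForm_val]
  congr 1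
  -- Conjugation by `e` is a ring homomorphism carrying one curvature to the other, hence also their
  -- powers, and it preserves the trace.
  let c := (LinearEquiv.conjRingEquiv e).toRingHom
  have hR : W.conn.curvSeq = V.conn.curvSeq.map c := by
    ext1 l
    by_cases hl : l.length = 2
    · obtain ⟨x, y, rfl⟩ := List.length_eq_two.1 hl
      ext1 w
      obtain ⟨v, rfl⟩ := e.surjective w
      change _ = e (V.conn.curv x y (e.symm (e v)))
      simp [Connection.curvSeq_pair, Connection.curv, ← he]
    · simp [Connection.curvSeq_of_length_ne _ _ hl]
  rw [hR, ← SeqFun.map_pow]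
  ext1 l
  exact (projTrace_comp_comm e.toLinearMap e.symm.toLinearMap _ (by ext; simp)).symm

/-- The forms `tr(R_∇^n)` are additive. -/
theorem Connection.projTrace_curvSeq_prod_pow {V W : Type*} [AddCommGroup V] [Module k V]
    [Module A V] [IsScalarTower k A V] [Module.Finite A V] [Module.Projective A V]
    [AddCommGroup W] [Module k W] [Module A W] [IsScalarTower k A W] [Module.Finite A W]
    [Module.Projective A W] (D : Connection k A g V) (D' : Connection k A g W) (n : ℕ) :
    ((D.prod D').curvSeq ^ n).map (projTrace A (V × W)) =
      (D.curvSeq ^ n).map (projTrace A V) + (D'.curvSeq ^ n).map (projTrace A W) := by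
  let c : Module.End A V × Module.End A W →+* Module.End A (V × W) :=
    (LinearMap.prodMapAlgHom A V W).toRingHom
  -- The curvature of the sum is the image of the pair `(R, R')` under the block diagonal ring
  -- homomorphism `c`, so its powers are computed in each block.
  let P : SeqFun g (Module.End A V × Module.End A W) := ⟨fun l => (D.curvSeq l, D'.curvSeq l)⟩
  have hR : (D.prod D').curvSeq = P.map c := by
    ext1 l
    by_cases hl : l.length = 2
    · obtain ⟨x, y, rfl⟩ := List.length_eq_two.1 hl
      exact LinearMap.ext fun w => rfl
    · change _ = c (_, _)
      rw [curvSeq_of_length_ne _ _ hl, curvSeq_of_length_ne _ _ hl, curvSeq_of_length_ne _ _ hl]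
      exact (map_zero c).symm
  have h1 : D.curvSeq = P.map (RingHom.fst _ _) := rfl
  have h2 : D'.curvSeq = P.map (RingHom.snd _ _) := rfl
  rw [hR, h1, h2, ← SeqFun.map_pow, ← SeqFun.map_pow, ← SeqFun.map_pow]
  ext1 l
  exact projTrace_prodMap _ _

theorem chForm_dsum (V W : ConnModule k A g) (n : ℕ) :
    chForm (V.dsum W) n = chForm V n + chForm W n := by
  apply Subtype.ext
  change (chForm (V.dsum W) n).1 = (chForm V n).1 + (chForm W n).1
  rw [chForm_val, chForm_val, chForm_val, ← smul_add]
  congr 1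
  exact V.conn.projTrace_curvSeq_prod_pow W.conn n

theorem Connection.curvSeq_canonical : (canonical k A g).curvSeq = 0 := by
  ext1 l
  by_cases hl : l.length = 2
  · obtain ⟨x, y, rfl⟩ := List.length_eq_two.1 hl
    exact canonical_curv k A g x y
  · exact curvSeq_of_length_ne _ _ hl

theorem chForm_unit_val (n : ℕ) : (chForm (ConnModule.unit k A g) n).1 =
    (n.factorial : k)⁻¹ • ((0 : SeqFun g (Module.End A A)) ^ n).map (projTrace A A) := by
  rw [← Connection.curvSeq_canonical (k := k)]
  rfl

theorem chForm_unit_zero : chForm (ConnModule.unit k A g) 0 = 1 := by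
  apply Subtype.ext
  rw [chForm_unit_val]
  change _ = (1 : SeqFun g A)
  ext l
  cases l with
  | nil => simp [projTrace_self]
  | cons x l => simp [SeqFun.one_cons]

theorem chForm_unit_of_ne_zero (n : ℕ) (hn : n ≠ 0) : chForm (ConnModule.unit k A g) n = 0 := by
  apply Subtype.ext
  rw [chForm_unit_val, zero_pow hn]
  change _ = (0 : SeqFun g A)
  ext l
  simp

/-! ### Curvature and trace on tensor products -/

section Tensor

open TensorProduct

variable {V W : Type*} [AddCommGroup V] [Module k V] [Module A V] [IsScalarTower k A V]
  [AddCommGroup W] [Module k W] [Module A W] [IsScalarTower k A W]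

/-- The curvature of a tensor product is `R ⊗ 1 + 1 ⊗ R'`. -/
theorem Connection.curvSeq_tensor (D : Connection k A g V) (D' : Connection k A g W) :
    (D.tensor D').curvSeq = D.curvSeq.map (Module.End.rTensorAlgHom A V W).toRingHom +
      D'.curvSeq.map (Module.End.lTensorAlgHom A W V).toRingHom := by
  ext1 l
  by_cases hl : l.length = 2
  · obtain ⟨x, y, rfl⟩ := List.length_eq_two.1 hl
    apply TensorProduct.ext'
    intro v w
    change (D.tensor D').curv x y (v ⊗ₜ w) = (D.curv x y v) ⊗ₜ w + v ⊗ₜ (D'.curv x y w)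
    simp [curv, tmul_sub, sub_tmul]
    abel
  · simp [curvSeq_of_length_ne _ _ hl]

variable [Module.Finite A W] [Module.Projective A W] [Module.Finite A V] [Module.Projective A V]

theorem map_projTrace_mul (F : SeqFun g (Module.End A V)) (G : SeqFun g (Module.End A W)) :
    (F.map (Module.End.rTensorAlgHom A V W).toRingHom *
      G.map (Module.End.lTensorAlgHom A W V).toRingHom).map (projTrace A (V ⊗[A] W)) =
      F.map (projTrace A V) * G.map (projTrace A W) := by
  ext l
  have h : ∀ (φ : Module.End A V) (ψ : Module.End A W),
      projTrace A (V ⊗[A] W) ((Module.End.rTensorAlgHom A V W).toRingHom φ *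
        (Module.End.lTensorAlgHom A W V).toRingHom ψ) = projTrace A V φ * projTrace A W ψ := by
    intro φ ψ
    rw [← projTrace_tensorMap]
    congr 1
    exact TensorProduct.ext' fun v w => rfl
  simp only [SeqFun.map_apply, SeqFun.mul_apply, map_list_sum, List.map_map]
  congr 1
  refine List.map_congr_left fun s _ => ?_
  simp only [Function.comp_apply, map_zsmul, h]

/-- `tr(exp)` is multiplicative. -/
theorem Connection.projTrace_curvSeq_tensor_pow [CharZero k] (D : Connection k A g V)
    (D' : Connection k A g W) (n : ℕ) :
    (n.factorial : k)⁻¹ • ((D.tensor D').curvSeq ^ n).map (projTrace A (V ⊗[A] W)) =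
      ∑ ij ∈ Finset.HasAntidiagonal.antidiagonal n,
        ((ij.1.factorial : k)⁻¹ • (D.curvSeq ^ ij.1).map (projTrace A V)) *
          ((ij.2.factorial : k)⁻¹ • (D'.curvSeq ^ ij.2).map (projTrace A W)) := by
  -- The values commute as they act on different tensor factors, and `R'` is even; graded
  -- commutativity with the identity as `τ` then gives honest commutation, which the binomial
  -- formula needs.
  have hc : Commute (D.curvSeq.map (Module.End.rTensorAlgHom A V W).toRingHom)
      (D'.curvSeq.map (Module.End.lTensorAlgHom A W V).toRingHom) := by
    ext1 l
    refine (SeqFun.graded_comm (AddMonoidHom.id (Module.End A (V ⊗[A] W))) _ _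
      (fun l l' => ?_) l).1 ?_
    · exact TensorProduct.ext' fun v w => rfl
    · ext1 l
      have := DFunLike.congr_fun D'.eps_curvSeq l
      rw [SeqFun.eps_apply] at this
      rw [SeqFun.eps_apply, SeqFun.map_apply, ← map_zsmul, this]
  have h := congrArg (traceSeq k A g (V ⊗[A] W)) (hc.add_pow' n)
  rw [← curvSeq_tensor, map_sum] at h
  change SeqFun.map _ _ = _ at h
  rw [h, Finset.smul_sum]
  refine Finset.sum_congr rfl fun ij hij => ?_
  rw [map_nsmul, ← SeqFun.map_pow, ← SeqFun.map_pow]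
  change _ • _ • SeqFun.map _ _ = _
  rw [map_projTrace_mul, smul_mul_smul_comm, ← Nat.cast_smul_eq_nsmul k, smul_smul]
  congr 1
  rw [Finset.HasAntidiagonal.mem_antidiagonal] at hij
  subst hij
  -- Characteristic zero makes the factorials invertible, so `(1/n!) (n choose i) = 1/(i! j!)` for
  -- `i + j = n`.
  have h0 : ∀ m : ℕ, (m.factorial : k) ≠ 0 := fun m => Nat.cast_ne_zero.2 m.factorial_ne_zero
  rw [Nat.cast_add_choose]
  field_simp [h0]

end Tensor

theorem chForm_tens [CharZero k] (V W : ConnModule k A g) (n : ℕ) :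
    chForm (V.tens W) n =
      ∑ ij ∈ Finset.HasAntidiagonal.antidiagonal n, chForm V ij.1 * chForm W ij.2 := by
  apply Subtype.ext
  rw [AddSubmonoidClass.coe_finsetSum]
  exact V.conn.projTrace_curvSeq_tensor_pow W.conn n

end

/-! ### The Chern character -/

/-- Pairs with `i, j < N` have `i + j < N + N`, so their products all occur on the left; any other
pair there contributes zero. -/
theorem sum_range_antidiagonal_mul {R : Type*} [Ring R] {a b : ℕ → R} {N : ℕ}
    (ha : ∀ n, N ≤ n → a n = 0) (hb : ∀ n, N ≤ n → b n = 0) :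
    ∑ n ∈ Finset.range (N + N), ∑ ij ∈ Finset.HasAntidiagonal.antidiagonal n, a ij.1 * b ij.2 =
      (∑ n ∈ Finset.range N, a n) * ∑ n ∈ Finset.range N, b n := by
  rw [Finset.sum_mul_sum, ← Finset.sum_product', Finset.sum_sigma']
  symm
  refine Finset.sum_of_injOn (fun ij => ⟨ij.1 + ij.2, ij⟩) ?_ ?_ ?_ fun _ _ => rfl
  · intro x _ y _ h
    exact eq_of_heq (Sigma.mk.inj h).2
  · intro x hx
    simp only [Finset.coe_product, Finset.coe_range, Set.mem_prod, Set.mem_Iio] at hx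
    simp only [Finset.coe_sigma, Set.mem_sigma_iff, Finset.coe_range, Set.mem_Iio,
      Finset.mem_coe, Finset.HasAntidiagonal.mem_antidiagonal]
    exact ⟨by omega, trivial⟩
  · rintro ⟨n, i, j⟩ hx hn
    simp only [Finset.mem_sigma, Finset.mem_range, Finset.HasAntidiagonal.mem_antidiagonal] at hx
    obtain ⟨-, rfl⟩ := hx
    by_cases hi : N ≤ i
    · simp [ha i hi]
    · by_cases hj : N ≤ j
      · simp [hb j hj]
      · exact absurd ⟨(i, j), by simpa using ⟨by omega, by omega⟩, rfl⟩ hn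

theorem map_sum_antidiagonal_mul {R S : Type*} [Ring R] [Ring S] (φ : R →+* S)
    (a b : ℕ → R) (n : ℕ) :
    φ (∑ ij ∈ Finset.HasAntidiagonal.antidiagonal n, a ij.1 * b ij.2) =
      ∑ ij ∈ Finset.HasAntidiagonal.antidiagonal n, φ (a ij.1) * φ (b ij.2) := by
  simp only [map_sum, map_mul]

section

variable {k : Type*} {A : Type u} {g : Type*} [Field k] [CharZero k] [CommRing A] [Algebra k A]
  [LieRing g] [LieAlgebra k g] [Module A g] [LieRingModule g A] [LieRinehartRing A g]
  [LieRinehartAlgebra k A g]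

/-- The class of `tr(exp R_∇)`. -/
noncomputable def chTotal (V : ConnModule k A g) : Cohomology k A g :=
  ∑ n ∈ Finset.range (exists_chClass_eq_zero V).choose, chClass V n

/-- Any bound beyond which the classes vanish gives the same sum, so bounds for different pairs can
be enlarged to a common one. -/
theorem chTotal_eq (V : ConnModule k A g) {N : ℕ} (hN : ∀ n, N ≤ n → chClass V n = 0) :
    chTotal V = ∑ n ∈ Finset.range N, chClass V n := by
  have h := (exists_chClass_eq_zero V).choose_spec
  rw [chTotal, ← Finset.eventually_constant_sum h (le_max_left _ N),
    Finset.eventually_constant_sum hN (le_max_right _ _)]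

theorem eventually_chTotal_eq (V : ConnModule k A g) :
    ∀ᶠ N in Filter.atTop, chTotal V = ∑ n ∈ Finset.range N, chClass V n := by
  obtain ⟨M, hM⟩ := exists_chClass_eq_zero V
  filter_upwards [Filter.eventually_ge_atTop M] with N hN
  exact chTotal_eq V fun n hn => hM n (hN.trans hn)

theorem chTotal_congr {V W : ConnModule k A g} (h : V.Iso W) : chTotal V = chTotal W := by
  have e : ∀ n, chClass V n = chClass W n := fun n =>
    congrArg (Cohomology.mk k A g) (Subtype.ext (chForm_congr h n))
  obtain ⟨N, hN⟩ := exists_chClass_eq_zero W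
  rw [chTotal_eq W hN, chTotal_eq V fun n hn => (e n).trans (hN n hn)]
  exact Finset.sum_congr rfl fun n _ => e n

theorem chTotal_dsum (V W : ConnModule k A g) : chTotal (V.dsum W) = chTotal V + chTotal W := by
  have e : ∀ n, chClass (V.dsum W) n = chClass V n + chClass W n := fun n => by
    rw [chClass, chClass, chClass, ← RingHom.map_add]
    exact congrArg (Cohomology.mk k A g) (Subtype.ext (chForm_dsum V W n))
  obtain ⟨N, hN⟩ := exists_chClass_eq_zero V
  obtain ⟨M, hM⟩ := exists_chClass_eq_zero W
  have hV : ∀ n, max N M ≤ n → chClass V n = 0 := fun n hn => hN n (by omega)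
  have hW : ∀ n, max N M ≤ n → chClass W n = 0 := fun n hn => hM n (by omega)
  rw [chTotal_eq V hV, chTotal_eq W hW,
    chTotal_eq (V.dsum W) fun n hn => by rw [e, hV n hn, hW n hn, add_zero],
    ← Finset.sum_add_distrib]
  exact Finset.sum_congr rfl fun n _ => e n

theorem chCocycle_tens (V W : ConnModule k A g) (n : ℕ) :
    chCocycle (V.tens W) n = ∑ ij ∈ Finset.HasAntidiagonal.antidiagonal n,
      chCocycle V ij.1 * chCocycle W ij.2 := by
  apply Subtype.ext
  rw [AddSubmonoidClass.coe_finsetSum]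
  exact chForm_tens V W n

theorem chClass_tens (V W : ConnModule k A g) (n : ℕ) :
    chClass (V.tens W) n = ∑ ij ∈ Finset.HasAntidiagonal.antidiagonal n,
      chClass V ij.1 * chClass W ij.2 :=
  (congrArg (Cohomology.mk k A g) (chCocycle_tens V W n)).trans
    (map_sum_antidiagonal_mul (Cohomology.mk k A g) (chCocycle V) (chCocycle W) n)

theorem chTotal_tens (V W : ConnModule k A g) : chTotal (V.tens W) = chTotal V * chTotal W := by
  have e := chClass_tens V W
  obtain ⟨N, hN⟩ := exists_chClass_eq_zero V
  obtain ⟨M, hM⟩ := exists_chClass_eq_zero W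
  have hV : ∀ n, max N M ≤ n → chClass V n = 0 := fun n hn => hN n (by omega)
  have hW : ∀ n, max N M ≤ n → chClass W n = 0 := fun n hn => hM n (by omega)
  rw [chTotal_eq V hV, chTotal_eq W hW, ← sum_range_antidiagonal_mul hV hW,
    chTotal_eq (V.tens W) (N := max N M + max N M) fun n hn => ?_]
  · exact Finset.sum_congr rfl fun n _ => e n
  · rw [e]
    refine Finset.sum_eq_zero fun ij hij => ?_
    rw [Finset.HasAntidiagonal.mem_antidiagonal] at hij
    -- If `i + j` is at least twice the common bound, then `i` or `j` reaches that bound.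
    by_cases h : max N M ≤ ij.1
    · rw [hV _ h, zero_mul]
    · rw [hW _ (by omega), mul_zero]

theorem chTotal_unit : chTotal (ConnModule.unit k A g) = 1 := by
  have h : ∀ n, 1 ≤ n → chClass (ConnModule.unit k A g) n = 0 := fun n hn => by
    rw [chClass, ← RingHom.map_zero (Cohomology.mk k A g)]
    exact congrArg _ (Subtype.ext (chForm_unit_of_ne_zero n (by omega)))
  rw [chTotal_eq _ h, Finset.sum_range_one, chClass, ← RingHom.map_one (Cohomology.mk k A g)]
  exact congrArg _ (Subtype.ext chForm_unit_zero)

/-- The Chern character on isomorphism classes. -/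
noncomputable def chIsoClass (k : Type*) (A : Type u) (g : Type*) [Field k] [CharZero k]
    [CommRing A] [Algebra k A] [LieRing g] [LieAlgebra k g] [Module A g] [LieRingModule g A]
    [LieRinehartRing A g] [LieRinehartAlgebra k A g] : IsoClass k A g →* Cohomology k A g where
  toFun := Quotient.lift chTotal fun _ _ h => chTotal_congr h
  map_one' := chTotal_unit
  map_mul' := by
    rintro ⟨V⟩ ⟨W⟩
    exact chTotal_tens V W

theorem liftMonoid_symb (V : ConnModule k A g) :
    FreeAbelianGroup.liftMonoid (chIsoClass k A g) (symb V) = chTotal V := by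
  rw [FreeAbelianGroup.liftMonoid_coe]
  exact FreeAbelianGroup.lift_apply_of (chIsoClass k A g) (Quotient.mk _ V : IsoClass k A g)

/-- The Chern character `ch : K_0(g) → H^*(g, A)`. -/
noncomputable def chernCharacter (k : Type*) (A : Type u) (g : Type*) [Field k] [CharZero k]
    [CommRing A] [Algebra k A] [LieRing g] [LieAlgebra k g] [Module A g] [LieRingModule g A]
    [LieRinehartRing A g] [LieRinehartAlgebra k A g] : K0 k A g →+* Cohomology k A g :=
  Ideal.Quotient.lift (relIdeal k A g) (FreeAbelianGroup.liftMonoid (chIsoClass k A g))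
    fun x hx => by
      -- The ideal is the additive closure of the relations by construction, so additivity on direct
      -- sums is all that is needed here.
      change x ∈ AddSubgroup.closure (relations k A g) at hx
      induction hx using AddSubgroup.closure_induction with
      | mem x hx =>
        obtain ⟨V, W, rfl⟩ := hx
        rw [map_sub, map_sub, liftMonoid_symb, liftMonoid_symb, liftMonoid_symb, chTotal_dsum]
        abel
      | zero => exact map_zero _
      | add x y _ _ hx hy => rw [map_add, hx, hy, add_zero]
      | neg x _ hx => rw [map_neg, hx, neg_zero]

theorem chernCharacter_mk (V : ConnModule k A g) :
    chernCharacter k A g (K0.mk V) = chTotal V :=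
  liftMonoid_symb V

/-- A ring homomorphism on `K_0(g)` is determined by its values on the classes `[W, ∇]`. -/
theorem K0.ringHom_ext {R : Type*} [Ring R] {φ ψ : K0 k A g →+* R}
    (h : ∀ V, φ (K0.mk V) = ψ (K0.mk V)) : φ = ψ := by
  refine Ideal.Quotient.ringHom_ext (RingHom.ext fun x => ?_)
  induction x using FreeAbelianGroup.induction_on with
  | zero => simp
  | of c =>
    obtain ⟨V, rfl⟩ := Quotient.exists_rep c
    exact h V
  | neg c hc => rw [map_neg, map_neg, hc]
  | add x y hx hy => rw [map_add, map_add, hx, hy]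

end
end LieRinehart

/-- Equality with the partial sums for all large `N` also encodes finiteness: consecutive partial
sums then agree, so the classes vanish for large `n`. -/
theorem theorem2 {k : Type*} {A : Type u} {g : Type*} [Field k] [CharZero k] [CommRing A]
    [Algebra k A] [LieRing g] [LieAlgebra k g] [Module A g] [LieRingModule g A]
    [LieRinehartRing A g] [LieRinehartAlgebra k A g] :
    ∃ hZ : ∀ (V : LieRinehart.ConnModule k A g) (n : ℕ),
        LieRinehart.chForm V n ∈ LieRinehart.cocycles k A g,
      ∃! ch : LieRinehart.K0 k A g →+* LieRinehart.Cohomology k A g,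
        ∀ V : LieRinehart.ConnModule k A g, ∀ᶠ N : ℕ in Filter.atTop,
          ch (LieRinehart.K0.mk V) =
            ∑ n ∈ Finset.range N,
              LieRinehart.Cohomology.mk k A g ⟨LieRinehart.chForm V n, hZ V n⟩ := by
  refine ⟨LieRinehart.chForm_mem_cocycles, LieRinehart.chernCharacter k A g, fun V => ?_,
    fun ch hch => LieRinehart.K0.ringHom_ext fun V => ?_⟩
  · simp only [LieRinehart.chernCharacter_mk]
    exact LieRinehart.eventually_chTotal_eq V
  -- At a common large `N` both homomorphisms have the same partial sum as value on `[W, ∇]`.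
  · obtain ⟨N, h1, h2⟩ := ((hch V).and (LieRinehart.eventually_chTotal_eq V)).exists
    rw [h1, LieRinehart.chernCharacter_mk, h2]
    rfl
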